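/- **Theorem (geometric decomposition of $\mathbb P_r\Lambda^k(T)$ with bubble forms).** *Setting.* Let $T\subset\mathbb R^d$ be a $d$-dimensional simplex with vertices $v_0,\dots,v_d$ and barycentric coordinates $\lambda_0,\dots,\lambda_d$. For $0\le \ell\le d$ let $\Delta_\ell(T)$ be the set of $\ell$-dimensional faces of $T$; a face $f$ is identified with its set of vertex indices, $\Delta_s(f)$ is the set of $s$-dimensional faces of $f$, $\mathscr T^f\subseteq\mathbb R^d$ is the tangent space of $f$, and $b_f=\prod_{i\in f}\lambda_i$. Let $\mathbb P_r(T)$ be the space of polynomial functions on $T$ of degree at most $r$ and $\mathbb P_r\Lambda^k(T)=\mathbb P_r(T)\otimes\operatorname{Alt}^k(\mathbb R^d)$, where $\operatorname{Alt}^k(V)$ is the space of alternating $k$-forms on $V$. For a face $f$ and an integer $q$, let $\mathbb P_q(f)\subseteq\mathbb P_q(T)$ denote the span of all monomials $\prod_{i\in f}\lambda_i^{\alpha_i}$ with $\alpha_i\in\mathbb N$ and $\sum_{i\in f}\alpha_i=q$ (so $\mathbb P_q(f)=\{0\}$ for $q<0$). Pull-back along the orthogonal projection $\mathbb R^d\to\mathscr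 T^f$ embeds $\operatorname{Alt}^k(\mathscr T^f)$ in $\operatorname{Alt}^k(\mathbb R^d)$; put $\mathbb P_q\Lambda^k(f)=\mathbb P_q(f)\otimes\operatorname{Alt}^k(\mathscr T^f)$, a space of $k$-forms on $T$. Fix an orientation of each $\mathscr T^f$ and, with $\ell=\dim f$, let $\star_f:\operatorname{Alt}^{\ell-k}(\mathscr T^f)\to\operatorname{Alt}^{k}(\mathscr T^f)$ be the Hodge star; it is applied pointwise to forms on $T$ with values in $\operatorname{Alt}^{\ell-k}(\mathscr T^f)$. For $f\in\Delta_\ell(T)$ with $\ell\ge k$ define $$\mathbb B_r\Lambda^k(f)=\bigoplus_{s=\ell-k}^{\ell}\ \bigoplus_{e\in\Delta_s(f)} b_e\star_f\mathbb P_{r-(s+1)}\Lambda^{\ell-k}(e).$$ *Claim.* Let $0\le k\le d$ and $r\ge1$. For every face $f$ with $\dim f\ge k$ the sum that defines $\mathbb B_r\Lambda^k(f)$ is direct, and $$\mathbb P_r\Lambda^k(T)=\bigoplus_{\ell=k}^{d}\ \bigoplus_{f\in\Delta_\ell(T)}\mathbb B_r\Lambda^k(f) =\bigoplus_{f\in\Delta_k(T)}\mathbb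 P_r\Lambda^k(f)\ \oplus\ \bigoplus_{\ell=k+1}^{d}\ \bigoplus_{f\in\Delta_\ell(T)}\mathbb B_r\Lambda^k(f),$$ where all sums are internal direct sums of subspaces of $\mathbb P_r\Lambda^k(T)$. -/

import Mathlib

open scoped BigOperators

noncomputable section

namespace BubbleForms

/-- Alternating `k`-forms `Alt^k(V)` on a real vector space. -/
abbrev Alt (k : ℕ) (V : Type*) [AddCommGroup V] [Module ℝ V] : Type _ := V [⋀^Fin k]→ₗ[ℝ] ℝ

/-- Pull-back of `k`-forms along a linear map. -/
def pullback {V W : Type*} [AddCommGroup V] [Module ℝ V] [AddCommGroup W] [Module ℝ W]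
    (k : ℕ) (g : V →ₗ[ℝ] W) : Alt k W →ₗ[ℝ] Alt k V where
  toFun ω := ω.compLinearMap g
  map_add' _ _ := rfl
  map_smul' _ _ := rfl

section Hodge

variable {V : Type*} [NormedAddCommGroup V] [InnerProductSpace ℝ V] {n j k : ℕ}

/-- The `k`-form `v ↦ vol(u₁, …, u_j, v₁, …, v_k)`, where `vol` is the volume form
of the orthonormal basis `b` and `j + k = n`. -/
def volContract (h : j + k = n) (b : OrthonormalBasis (Fin n) ℝ V) (u : Fin j → V) : Alt k V where
  toFun v := b.toBasis.det (Sum.elim u v ∘ (finSumFinEquiv.trans (finCongr h)).symm)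
  map_update_add' v i x y := by
    have hh := ((b.toBasis.det).domDomCongr
      (finSumFinEquiv.trans (finCongr h)).symm).map_update_add (Sum.elim u v) (Sum.inr i) x y
    simp only [AlternatingMap.domDomCongr_apply] at hh
    simp only [← Sum.update_elim_inr]
    convert hh using 3
  map_update_smul' v i c x := by
    have hh := ((b.toBasis.det).domDomCongr
      (finSumFinEquiv.trans (finCongr h)).symm).map_update_smul (Sum.elim u v) (Sum.inr i) c x
    simp only [AlternatingMap.domDomCongr_apply] at hh
    simp only [← Sum.update_elim_inr]
    convert hh using 3
  map_eq_zero_of_eq' v i i' hv hne :=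
    ((b.toBasis.det).domDomCongr
      (finSumFinEquiv.trans (finCongr h)).symm).map_eq_zero_of_eq (Sum.elim u v)
      (i := Sum.inr i) (j := Sum.inr i') hv (fun hc => hne (Sum.inr_injective hc))

open Classical in
/-- The Hodge star `⋆ : Alt^j(V) → Alt^k(V)`, `j + k = n = dim V`, for the orientation in which the
orthonormal basis `b` is positive. Since `ω = ∑_σ ω(b_σ) dx_σ` and
`vol(b_σ, ·) = sign(σ, σᶜ) dx_{σᶜ}`, this is the linear map with
`⋆ dx_σ = sign(σ, σᶜ) dx_{σᶜ}`; the sum is over the increasing `σ : {1..j} → {1..n}`. -/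
def hodgeStar (h : j + k = n) (b : OrthonormalBasis (Fin n) ℝ V) : Alt j V →ₗ[ℝ] Alt k V where
  toFun ω := ∑ σ : Fin j → Fin n with StrictMono σ, ω (b ∘ σ) • volContract h b (b ∘ σ)
  map_add' ω η := by
    simp only [AlternatingMap.add_apply, add_smul, Finset.sum_add_distrib]
  map_smul' c ω := by
    simp only [AlternatingMap.smul_apply, smul_assoc, Finset.smul_sum, RingHom.id_apply]

end Hodge

/-- A face of a `d`-simplex, given by its nonempty set of vertices. -/
abbrev Face (d : ℕ) : Type := {f : Finset (Fin (d + 1)) // f.Nonempty}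

/-- Dimension of a face: number of vertices minus one. -/
def Face.dim {d : ℕ} (f : Face d) : ℕ := f.1.card - 1

/-- `W` is the internal direct sum of the family `A` of subspaces. -/
def IsDirectSum {M ι : Type*} [AddCommGroup M] [Module ℝ M]
    (W : Submodule ℝ M) (A : ι → Submodule ℝ M) : Prop :=
  iSupIndep A ∧ ⨆ i, A i = W

/-- `P ⊗ A` for a space `P` of scalar functions on `X` and a subspace `A` of `M`, as a space of
`M`-valued functions on `X`. -/
def tensor {X M : Type*} [AddCommGroup M] [Module ℝ M]
    (P : Submodule ℝ (X → ℝ)) (A : Submodule ℝ M) : Submodule ℝ (X → M) :=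
  Submodule.span ℝ {F | ∃ p ∈ P, ∃ a ∈ A, F = fun x => p x • a}

section Simplex

variable {d : ℕ} (T : Affine.Simplex ℝ (EuclideanSpace ℝ (Fin d)) d)

/-- The geometric simplex: the convex hull of the vertices. -/
abbrev body : Set (EuclideanSpace ℝ (Fin d)) := convexHull ℝ (Set.range T.points)

/-- The vertices of `T` as an affine basis of `ℝ^d`. -/
def vertexBasis : AffineBasis (Fin (d + 1)) ℝ (EuclideanSpace ℝ (Fin d)) :=
  ⟨T.points, T.independent, T.span_eq_top (by simp)⟩

/-- The barycentric coordinate `λ_i`, as a function on `T`. -/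
def bary (i : Fin (d + 1)) : body T → ℝ := fun x => (vertexBasis T).coord i x.1

/-- `P_r(T)`: the functions on `T` that are polynomials of total degree at most `r`. -/
def polyT (r : ℕ) : Submodule ℝ (body T → ℝ) :=
  (MvPolynomial.restrictTotalDegree (Fin d) ℝ r).map
    (LinearMap.pi fun x : body T =>
      (MvPolynomial.aeval (R := ℝ) (fun i => x.1 i) : MvPolynomial (Fin d) ℝ →ₐ[ℝ] ℝ).toLinearMap)

/-- `P_rΛ^k(T) = P_r(T) ⊗ Alt^k(ℝ^d)`. -/
def polyFormsT (r k : ℕ) : Submodule ℝ (body T → Alt k (EuclideanSpace ℝ (Fin d))) :=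
  tensor (polyT T r) ⊤

/-- `P_q(f)` inside the functions on `T` via the Bernstein extension: the span of the monomials
`λ^α` with `α` supported on the vertices of `f` and `|α| = q`. It is `0` for `q < 0`. -/
def polyFace (f : Face d) (q : ℤ) : Submodule ℝ (body T → ℝ) :=
  Submodule.span ℝ {p | ∃ α : Fin (d + 1) → ℕ, (∀ i, i ∉ f.1 → α i = 0) ∧
    ((∑ i, α i : ℕ) : ℤ) = q ∧ p = fun x => ∏ i, bary T i x ^ α i}

/-- The bubble polynomial `b_f = ∏_{i ∈ f} λ_i`. -/
def bubble (f : Face d) : body T → ℝ := fun x => ∏ i ∈ f.1, bary T i x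

/-- The tangent space of the face `f`. -/
def tangent (f : Face d) : Submodule ℝ (EuclideanSpace ℝ (Fin d)) :=
  vectorSpan ℝ (T.points '' (f.1 : Set (Fin (d + 1))))

/-- The embedding `Alt^k(𝒯^f) → Alt^k(ℝ^d)`: pull-back along the orthogonal projection. -/
def extend (k : ℕ) (f : Face d) : Alt k (tangent T f) →ₗ[ℝ] Alt k (EuclideanSpace ℝ (Fin d)) :=
  pullback k (tangent T f).orthogonalProjectionOnto.toLinearMap

/-- The restriction `Alt^k(ℝ^d) → Alt^k(𝒯^f)`, a left inverse of `extend`. -/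
def restrict (k : ℕ) (f : Face d) : Alt k (EuclideanSpace ℝ (Fin d)) →ₗ[ℝ] Alt k (tangent T f) :=
  pullback k (tangent T f).subtype

/-- `P_qΛ^k(f) = P_q(f) ⊗ Alt^k(𝒯^f)`, embedded in the `k`-forms on `T`. -/
def polyFormsFace (f : Face d) (q : ℤ) (k : ℕ) :
    Submodule ℝ (body T → Alt k (EuclideanSpace ℝ (Fin d))) :=
  tensor (polyFace T f q) (LinearMap.range (extend T k f))

/-- `⋆_f` on forms on `𝒯^f`, all forms on `𝒯^f` being embedded in the forms on `ℝ^d`: for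
`ω ∈ Alt^{ℓ-k}(𝒯^f)`, `ℓ = dim f`, it sends `extend ω` to `extend (⋆ ω)`. -/
def starFace (f : Face d) (b : OrthonormalBasis (Fin f.dim) ℝ (tangent T f)) (k : ℕ)
    (hk : k ≤ f.dim) :
    Alt (f.dim - k) (EuclideanSpace ℝ (Fin d)) →ₗ[ℝ] Alt k (EuclideanSpace ℝ (Fin d)) :=
  extend T k f ∘ₗ hodgeStar (Nat.sub_add_cancel hk) b ∘ₗ restrict T (f.dim - k) f

/-- `b_e ⋆_f P_{r-(s+1)}Λ^{ℓ-k}(e)` with `ℓ = dim f`, `s = dim e`: the image of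
`P_{r-(s+1)}Λ^{ℓ-k}(e)` under the pointwise map `ω ↦ b_e ⋆_f ω`. -/
def bubbleTerm (f : Face d) (b : OrthonormalBasis (Fin f.dim) ℝ (tangent T f)) (r k : ℕ)
    (hk : k ≤ f.dim) (e : Face d) :
    Submodule ℝ (body T → Alt k (EuclideanSpace ℝ (Fin d))) :=
  (polyFormsFace T e ((r : ℤ) - (e.dim + 1)) (f.dim - k)).map
    (LinearMap.pi fun x : body T =>
      bubble T e x • (starFace T f b k hk ∘ₗ LinearMap.proj x))

/-- The faces `e ⊆ f` with `ℓ - k ≤ dim e`, `ℓ = dim f` (automatically `dim e ≤ ℓ`). -/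
abbrev BubbleIndex (f : Face d) (k : ℕ) : Type :=
  {e : Face d // e.1 ⊆ f.1 ∧ f.dim - k ≤ e.dim}

/-- The bubble space `B_rΛ^k(f)`: the sum of its defining pieces. -/
def bubbleForms (f : Face d) (b : OrthonormalBasis (Fin f.dim) ℝ (tangent T f)) (r k : ℕ)
    (hk : k ≤ f.dim) : Submodule ℝ (body T → Alt k (EuclideanSpace ℝ (Fin d))) :=
  ⨆ e : BubbleIndex f k, bubbleTerm T f b r k hk e.1

end Simplex

end BubbleForms

end

/-! The barycentric monomials λ^α with |α| = r form a basis of P_r(T), so a polynomial k-form is a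
family of coefficients in Alt^k(ℝ^d), one for each α. Multiplication by b_e carries the monomials of
degree r-(s+1) in the coordinates of e onto the monomials of degree r with support exactly e. Hence
b_e ⋆_f P_{r-(s+1)}Λ^{ℓ-k}(e) consists of the families with values in ⋆_f Alt^{ℓ-k}(𝒯^e) at the α
with support e, and zero elsewhere. What remains is algebra for one fixed face e: Alt^k(ℝ^d) must be
the direct sum of the spaces ⋆_f Alt^{ℓ-k}(𝒯^e) over the admissible f ⊇ e.

Take as basis of ℝ^d an orthonormal basis of 𝒯^e together with the gradients of the λ_i, i ∉ e, and
label each gradient by i. The Hodge star exchanges "killed by m" with "zero on tuples orthogonal to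
m" (`hodgeStar_apply_eq_zero_of_killedBy`, `killedBy_hodgeStar`). It follows that ⋆_f Alt^{ℓ-k}(𝒯^e)
is the space of forms that see only those tuples of basis vectors whose set of labels is f \ e
(`starImage_eq_supportedForms`). Sorting tuples by label set splits Alt^k(ℝ^d)
(`isDirectSum_supportedForms`), and counting shows that the nonzero summands come from admissible f
(`exists_face_of_supportedForms_ne_bot`).

`isDirectSum_bubbleTerm` assembles these splittings over all α; grouping by f gives the first
decomposition. If dim f = k, the star image is all of Alt^k(𝒯^f) for every e ⊆ f, which gives the
second. -/

namespace BubbleForms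

/-! ### Alternating forms: sums over tuples, and vectors that kill a form. -/

section Alternating

/-- A sum over all tuples of a symmetric function that vanishes on tuples with repetitions is a
multiple of the sum over the increasing tuples. -/
theorem sum_eq_factorial_mul_sum_strictMono {j n : ℕ}
    [DecidablePred fun σ : Fin j → Fin n => StrictMono σ]
    (F : (Fin j → Fin n) → ℝ)
    (hperm : ∀ σ (π : Equiv.Perm (Fin j)), F (σ ∘ π) = F σ)
    (hinj : ∀ σ, ¬ Function.Injective σ → F σ = 0) :
    ∑ σ, F σ = (j.factorial : ℝ) * ∑ σ with StrictMono σ, F σ := by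
  classical
  have h1 : ∑ σ, F σ = ∑ σ with Function.Injective σ, F σ := by
    rw [Finset.sum_filter]
    refine Finset.sum_congr rfl fun σ _ => ?_
    split_ifs with h
    · rfl
    · exact hinj σ h
  have h2 : ∑ p ∈ (Finset.univ.filter fun σ : Fin j → Fin n => StrictMono σ) ×ˢ
      (Finset.univ : Finset (Equiv.Perm (Fin j))), F p.1 = ∑ σ with Function.Injective σ, F σ := by
    refine Finset.sum_nbij (fun p => p.1 ∘ p.2) ?_ ?_ ?_ ?_
    · rintro ⟨τ, π⟩ hp
      simp only [Finset.mem_product, Finset.mem_filter, Finset.mem_univ, true_and, and_true] at hp ⊢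
      exact hp.injective.comp π.injective
    · rintro ⟨τ, π⟩ hp ⟨τ', π'⟩ hp' h
      simp only [Finset.coe_product, Finset.coe_filter, Finset.mem_univ, true_and, Finset.coe_univ,
        Set.mem_prod, Set.mem_ofPred_eq, Set.mem_univ, and_true] at hp hp'
      have hr : τ = τ' := by
        rw [← hp.range_inj hp']
        have := congrArg Set.range h
        simpa [Set.range_comp] using this
      subst hr
      have : π = π' := by
        ext i
        exact congrArg _ (hp.injective (congrFun h i))
      rw [this]
    · intro σ hσ
      simp only [Finset.coe_filter, Finset.mem_univ, true_and, Set.mem_ofPred_eq] at hσ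
      -- An injective tuple is an increasing one followed by a permutation; sorting finds both.
      refine ⟨(σ ∘ Tuple.sort σ, (Tuple.sort σ)⁻¹), ?_, ?_⟩
      · simp only [Finset.coe_product, Finset.coe_filter, Finset.mem_univ, true_and,
          Finset.coe_univ, Set.mem_prod, Set.mem_ofPred_eq, Set.mem_univ, and_true]
        exact (Tuple.monotone_sort σ).strictMono_of_injective
          (hσ.comp (Tuple.sort σ).injective)
      · funext i
        simp
    · rintro ⟨τ, π⟩ _
      exact (hperm τ π).symm
  rw [h1, ← h2, Finset.sum_product, Finset.mul_sum]
  refine Finset.sum_congr rfl fun σ _ => ?_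
  simp [Fintype.card_perm]

variable {ι V : Type*} [AddCommGroup V] [Module ℝ V]

/-- `ω` vanishes as soon as one of its arguments is `n`. -/
def KilledBy (ω : V [⋀^ι]→ₗ[ℝ] ℝ) (n : V) : Prop := ∀ v : ι → V, (∃ i, v i = n) → ω v = 0

theorem KilledBy.of_mem_span {ω : V [⋀^ι]→ₗ[ℝ] ℝ} {S : Set V} (h : ∀ n ∈ S, KilledBy ω n) {n : V}
    (hn : n ∈ Submodule.span ℝ S) : KilledBy ω n := by
  classical
  induction hn using Submodule.span_induction with
  | mem x hx => exact h x hx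
  | zero => rintro v ⟨i, hi⟩; exact ω.map_coord_zero i hi
  | add x y _ _ hx hy =>
    rintro v ⟨i, hi⟩
    rw [← Function.update_eq_self i v, hi, ω.map_update_add, hx _ ⟨i, by simp⟩, hy _ ⟨i, by simp⟩,
      add_zero]
  | smul c x _ hx =>
    rintro v ⟨i, hi⟩
    rw [← Function.update_eq_self i v, hi, ω.map_update_smul, hx _ ⟨i, by simp⟩, smul_zero]

/-- Arguments are exchanged one at a time; each exchange costs a value of `ω` with a killing vector
among its arguments. -/
theorem eq_of_forall_killedBy_sub [Finite ι] {ω : V [⋀^ι]→ₗ[ℝ] ℝ} {v w : ι → V}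
    (h : ∀ i, KilledBy ω (v i - w i)) : ω v = ω w := by
  classical
  cases nonempty_fintype ι
  have key : ∀ s : Finset ι, ω (s.piecewise w v) = ω v := by
    intro s
    induction s using Finset.induction_on with
    | empty => simp
    | insert a s ha ih =>
      rw [Finset.piecewise_insert, ← ih]
      have h1 : w a = v a + (-1 : ℝ) • (v a - w a) := by simp
      have h2 : s.piecewise w v = Function.update (s.piecewise w v) a (v a) := by
        rw [eq_comm, Function.update_eq_self_iff]
        simp [ha]
      have h3 : ω (Function.update (s.piecewise w v) a (v a - w a)) = 0 := h a _ ⟨a, by simp⟩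
      rw [h1, ω.map_update_add, ω.map_update_smul, h3, smul_zero, add_zero, ← h2]
  simpa using (key Finset.univ).symm

end Alternating

/-! ### The Hodge star: involution up to sign, and duality of vanishing conditions. -/

section Hodge

variable {V : Type*} [NormedAddCommGroup V] [InnerProductSpace ℝ V] {n j k : ℕ}

open scoped RealInnerProductSpace

/-- The volume form of an orthonormal basis, with arguments split in two groups. -/
noncomputable def volForm (h : j + k = n) (b : OrthonormalBasis (Fin n) ℝ V) :
    V [⋀^Fin j ⊕ Fin k]→ₗ[ℝ] ℝ :=
  b.toBasis.det.domDomCongr (finSumFinEquiv.trans (finCongr h)).symm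

theorem hodgeStar_apply (h : j + k = n) (b : OrthonormalBasis (Fin n) ℝ V) (α : Alt j V)
    (v : Fin k → V) [DecidablePred fun σ : Fin j → Fin n => StrictMono σ] :
    hodgeStar h b α v = ∑ σ : Fin j → Fin n with StrictMono σ,
      α (b ∘ σ) * volForm h b (Sum.elim (b ∘ σ) v) := by
  simp only [hodgeStar, LinearMap.coe_mk, AddHom.coe_mk]
  let ev : Alt k V →+ ℝ := ⟨⟨fun ω => ω v, rfl⟩, fun _ _ => rfl⟩
  refine (map_sum ev _ _).trans ?_
  congr!

theorem volForm_comp_eq_zero (h : j + k = n) (b : OrthonormalBasis (Fin n) ℝ V)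
    (σ : Fin j → Fin n) (τ : Fin k → Fin n) (hne : ¬ Function.Injective (Sum.elim σ τ)) :
    volForm h b (Sum.elim (b ∘ σ) (b ∘ τ)) = 0 := by
  refine AlternatingMap.map_eq_zero_of_not_injective _ _ fun hc => hne ?_
  rw [← Sum.comp_elim] at hc
  exact hc.of_comp

/-- The indices form a permutation of all of `Fin n`, so the volume form takes the value ±1. -/
theorem volForm_comp_mul_self (h : j + k = n) (b : OrthonormalBasis (Fin n) ℝ V)
    (σ : Fin j → Fin n) (τ : Fin k → Fin n) (hinj : Function.Injective (Sum.elim σ τ)) :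
    volForm h b (Sum.elim (b ∘ σ) (b ∘ τ)) * volForm h b (Sum.elim (b ∘ σ) (b ∘ τ)) = 1 := by
  set e := (finSumFinEquiv.trans (finCongr h)).symm with he
  have hb : Function.Bijective (Sum.elim σ τ ∘ e) :=
    Finite.injective_iff_bijective.mp (hinj.comp e.injective)
  have h1 : volForm h b (Sum.elim (b ∘ σ) (b ∘ τ)) =
      b.toBasis.det (b.toBasis ∘ Equiv.ofBijective _ hb) := by
    rw [← Sum.comp_elim, volForm, AlternatingMap.domDomCongr_apply]
    congr 1
  rw [h1, AlternatingMap.map_perm, Module.Basis.det_self]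
  rcases Int.units_eq_one_or (Equiv.Perm.sign (Equiv.ofBijective _ hb)) with h | h <;> simp [h]

/-- Exchanging the two groups of arguments of the volume form costs a sign. -/
theorem exists_volForm_swap (h : j + k = n) (h' : k + j = n) (b : OrthonormalBasis (Fin n) ℝ V) :
    ∃ c : ℝ, c * c = 1 ∧ ∀ (u : Fin j → V) (v : Fin k → V),
      volForm h' b (Sum.elim v u) = c * volForm h b (Sum.elim u v) := by
  set e := finSumFinEquiv.trans (finCongr h) with he
  set e' := finSumFinEquiv.trans (finCongr h') with he'
  -- The permutation that interchanges the two blocks; its sign is the constant.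
  let π : Equiv.Perm (Fin n) := e'.symm.trans ((Equiv.sumComm _ _).trans e)
  refine ⟨((Equiv.Perm.sign π : ℤ) : ℝ), ?_, fun u v => ?_⟩
  · rcases Int.units_eq_one_or (Equiv.Perm.sign π) with h | h <;> simp [h]
  · have h1 : Sum.elim v u ∘ e'.symm = (Sum.elim u v ∘ e.symm) ∘ π := by
      funext i
      simp only [Function.comp_apply, π, Equiv.trans_apply, Equiv.symm_apply_apply,
        Equiv.sumComm_apply]
      cases e'.symm i <;> rfl
    have h2 := AlternatingMap.map_perm b.toBasis.det (Sum.elim u v ∘ e.symm) π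
    rw [← h1] at h2
    simp only [volForm, AlternatingMap.domDomCongr_apply]
    refine h2.trans ?_
    rw [Units.smul_def, zsmul_eq_mul]

theorem exists_strictMono_complement (h : j + k = n) (σ : Fin j → Fin n) (hσ : StrictMono σ) :
    ∃ τ : Fin k → Fin n, StrictMono τ ∧ Function.Injective (Sum.elim σ τ) := by
  classical
  let s : Finset (Fin n) := (Finset.univ.image σ)ᶜ
  have hs : s.card = k := by
    rw [Finset.card_compl, Finset.card_image_of_injective _ hσ.injective]
    simp; omega
  refine ⟨s.orderEmbOfFin hs, (s.orderEmbOfFin hs).strictMono, ?_⟩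
  refine hσ.injective.sumElim (s.orderEmbOfFin hs).injective fun a c hac => ?_
  have : s.orderEmbOfFin hs c ∈ s := Finset.orderEmbOfFin_mem _ _ _
  rw [← hac] at this
  simp [s] at this

theorem range_eq_compl_of_injective_elim (h : j + k = n) {σ : Fin j → Fin n} {τ : Fin k → Fin n}
    (hinj : Function.Injective (Sum.elim σ τ)) : Set.range τ = (Set.range σ)ᶜ := by
  have hb : Function.Bijective (Sum.elim σ τ) :=
    (Fintype.bijective_iff_injective_and_card _).2 ⟨hinj, by simp [h]⟩
  ext x
  constructor
  · rintro ⟨a, rfl⟩ ⟨c, hc⟩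
    have := @hinj (Sum.inl c) (Sum.inr a) hc
    simp at this
  · intro hx
    obtain ⟨y, rfl⟩ := hb.2 x
    cases y with
    | inl y => exact absurd ⟨y, rfl⟩ hx
    | inr y => exact ⟨y, rfl⟩

/-- Only the increasing tuple complementary to `τ` survives in the sum: any other shares an index
with `τ`. -/
theorem hodgeStar_apply_complement (h : j + k = n) (b : OrthonormalBasis (Fin n) ℝ V) (α : Alt j V)
    {σ : Fin j → Fin n} {τ : Fin k → Fin n} (hσ : StrictMono σ)
    (hinj : Function.Injective (Sum.elim σ τ)) :
    hodgeStar h b α (b ∘ τ) = α (b ∘ σ) * volForm h b (Sum.elim (b ∘ σ) (b ∘ τ)) := by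
  classical
  rw [hodgeStar_apply]
  refine Finset.sum_eq_single_of_mem σ (by simpa using hσ) fun σ' hσ' hne => ?_
  rw [volForm_comp_eq_zero, mul_zero]
  intro hc
  refine hne ((StrictMono.range_inj (by simpa using hσ') hσ).1 ?_)
  rw [← compl_inj_iff, ← range_eq_compl_of_injective_elim h hc,
    ← range_eq_compl_of_injective_elim h hinj]

/-- The Hodge star is an involution up to sign. -/
theorem exists_hodgeStar_hodgeStar (h : j + k = n) (h' : k + j = n)
    (b : OrthonormalBasis (Fin n) ℝ V) :
    ∃ c : ℝ, c * c = 1 ∧ ∀ α : Alt j V, hodgeStar h' b (hodgeStar h b α) = c • α := by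
  obtain ⟨c, hc, hswap⟩ := exists_volForm_swap h h' b
  refine ⟨c, hc, fun α => ?_⟩
  have key : ∀ σ : Fin j → Fin n, StrictMono σ →
      hodgeStar h' b (hodgeStar h b α) (b ∘ σ) = c * α (b ∘ σ) := by
    intro σ hσ
    obtain ⟨τ, hτ, hinj⟩ := exists_strictMono_complement h σ hσ
    have hinj' : Function.Injective (Sum.elim τ σ) := by
      have := hinj.comp (Equiv.sumComm _ _).injective
      convert this using 1
      funext x
      cases x <;> rfl
    rw [hodgeStar_apply_complement h' b _ hτ hinj', hodgeStar_apply_complement h b _ hσ hinj, hswap]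
    linear_combination c * α (b ∘ σ) * volForm_comp_mul_self h b σ τ hinj
  refine b.toBasis.ext_alternating fun σ hσ => ?_
  have h1 : (fun i => b.toBasis (σ i)) = (b ∘ (σ ∘ Tuple.sort σ)) ∘ ⇑(Tuple.sort σ)⁻¹ := by
    funext i
    simp
  rw [h1, AlternatingMap.map_perm, AlternatingMap.map_perm, key _
    ((Tuple.monotone_sort σ).strictMono_of_injective (hσ.comp (Tuple.sort σ).injective))]
  rfl

/-- The sum over all tuples is a full contraction of two multilinear maps, to which
`sum_comp_symmetric` applies; the sum over increasing tuples does not have that form. -/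
theorem factorial_mul_hodgeStar_apply (h : j + k = n) (b : OrthonormalBasis (Fin n) ℝ V)
    (α : Alt j V) (v : Fin k → V) :
    (j.factorial : ℝ) * hodgeStar h b α v =
      ∑ σ : Fin j → Fin n, α (b ∘ σ) * volForm h b (Sum.elim (b ∘ σ) v) := by
  classical
  rw [hodgeStar_apply, sum_eq_factorial_mul_sum_strictMono]
  · intro σ π
    have h1 : Sum.elim (b ∘ σ ∘ π) v =
        Sum.elim (b ∘ σ) v ∘ (Equiv.sumCongr π (Equiv.refl (Fin k))) := by
      funext x
      cases x <;> rfl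
    rw [h1, ← Function.comp_assoc, AlternatingMap.map_perm, AlternatingMap.map_perm,
      Equiv.Perm.sign_sumCongr]
    rcases Int.units_eq_one_or (Equiv.Perm.sign π) with h | h <;> simp [h]
  · intro σ hσ
    rw [α.map_eq_zero_of_not_injective _ fun hc => hσ hc.of_comp, zero_mul]

/-- A self-adjoint map may be moved from one factor of a contraction to the other. -/
theorem sum_comp_symmetric (b : OrthonormalBasis (Fin n) ℝ V) {P : V →ₗ[ℝ] V} (hP : P.IsSymmetric)
    (A B : MultilinearMap ℝ (fun _ : Fin j => V) ℝ) :
    ∑ σ : Fin j → Fin n, A (P ∘ b ∘ σ) * B (b ∘ σ) =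
      ∑ σ : Fin j → Fin n, A (b ∘ σ) * B (P ∘ b ∘ σ) := by
  classical
  have expand : ∀ (A : MultilinearMap ℝ (fun _ : Fin j => V) ℝ) (σ : Fin j → Fin n),
      A (P ∘ b ∘ σ) = ∑ τ : Fin j → Fin n, (∏ i, ⟪b (τ i), P (b (σ i))⟫) * A (b ∘ τ) := by
    intro A σ
    have h1 : P ∘ b ∘ σ = fun i => ∑ m, ⟪b m, P (b (σ i))⟫ • b m := by
      funext i
      exact (b.sum_repr' _).symm
    rw [h1, A.map_sum]
    refine Finset.sum_congr rfl fun τ _ => ?_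
    rw [A.map_smul_univ]
    rfl
  simp only [expand, Finset.sum_mul, Finset.mul_sum]
  rw [Finset.sum_comm]
  refine Finset.sum_congr rfl fun τ _ => Finset.sum_congr rfl fun σ _ => ?_
  have : ∏ i, ⟪b (τ i), P (b (σ i))⟫ = ∏ i, ⟪b (σ i), P (b (τ i))⟫ :=
    Finset.prod_congr rfl fun i _ => by rw [← hP, real_inner_comm]
  rw [this]
  ring

/-- The projection onto the orthogonal complement of `m`. -/
noncomputable def projAway (m : V) : V →ₗ[ℝ] V :=
  LinearMap.id - (⟪m, m⟫)⁻¹ • (innerₛₗ ℝ m).smulRight m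

theorem projAway_apply (m x : V) : projAway m x = x - ((⟪m, m⟫)⁻¹ * ⟪m, x⟫) • m := by
  simp [projAway, smul_smul]

theorem projAway_isSymmetric (m : V) : (projAway m).IsSymmetric := by
  intro x y
  simp only [projAway_apply, inner_sub_left, inner_sub_right, real_inner_smul_left,
    real_inner_smul_right, real_inner_comm m]
  ring

theorem inner_projAway {m : V} (hm : m ≠ 0) (x : V) : ⟪m, projAway m x⟫ = 0 := by
  have : ⟪m, m⟫ ≠ 0 := inner_self_ne_zero.2 hm
  rw [projAway_apply, inner_sub_right, real_inner_smul_right]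
  field_simp
  ring

theorem KilledBy.comp_projAway {ι : Type*} [Finite ι] {ω : V [⋀^ι]→ₗ[ℝ] ℝ} {m : V}
    (h : KilledBy ω m) (v : ι → V) : ω (projAway m ∘ v) = ω v := by
  refine eq_of_forall_killedBy_sub fun i => ?_
  refine KilledBy.of_mem_span (S := {m}) (by simpa using h) ?_
  rw [Function.comp_apply, projAway_apply, sub_sub_cancel_left]
  exact Submodule.neg_mem _ (Submodule.smul_mem _ _ (Submodule.mem_span_singleton_self m))

/-- The volume form vanishes on tuples that lie in a hyperplane. -/
theorem volForm_eq_zero_of_inner_eq_zero (h : j + k = n) (b : OrthonormalBasis (Fin n) ℝ V) {m : V}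
    (hm : m ≠ 0) (w : Fin j ⊕ Fin k → V) (hw : ∀ i, ⟪m, w i⟫ = 0) : volForm h b w = 0 := by
  by_contra hne
  set w' := w ∘ (finSumFinEquiv.trans (finCongr h)).symm
  have hdet : IsUnit (b.toBasis.det w') := isUnit_iff_ne_zero.2 hne
  obtain ⟨-, hspan⟩ := (Module.Basis.is_basis_iff_det b.toBasis).2 hdet
  have h1 : ∀ x ∈ Submodule.span ℝ (Set.range w'), ⟪m, x⟫ = 0 := by
    intro x hx
    induction hx using Submodule.span_induction with
    | mem x hx => obtain ⟨i, rfl⟩ := hx; exact hw _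
    | zero => simp
    | add x y _ _ hx hy => rw [inner_add_right, hx, hy, add_zero]
    | smul c x _ hx => rw [real_inner_smul_right, hx, mul_zero]
  exact hm (inner_self_eq_zero.1 (h1 m (hspan ▸ Submodule.mem_top)))

/-- The volume form with the second group of arguments fixed. -/
noncomputable def volLeft (h : j + k = n) (b : OrthonormalBasis (Fin n) ℝ V) (v : Fin k → V) :
    MultilinearMap ℝ (fun _ : Fin j => V) ℝ where
  toFun u := volForm h b (Sum.elim u v)
  map_update_add' u i x y := by
    have h1 : ∀ z, Sum.elim (Function.update u i z) v =
      Function.update (Sum.elim u v) (Sum.inl i) z := fun z => Sum.update_elim_inl.symm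
    have h2 := (volForm h b).map_update_add (Sum.elim u v) (Sum.inl i) x y
    rw [← h1, ← h1, ← h1] at h2
    convert h2 using 3
  map_update_smul' u i c x := by
    have h1 : ∀ z, Sum.elim (Function.update u i z) v =
      Function.update (Sum.elim u v) (Sum.inl i) z := fun z => Sum.update_elim_inl.symm
    have h2 := (volForm h b).map_update_smul (Sum.elim u v) (Sum.inl i) c x
    rw [← h1, ← h1] at h2
    convert h2 using 3

/-- If `α` is killed by `m`, then `⋆ α` vanishes on tuples orthogonal to `m`. -/
theorem hodgeStar_apply_eq_zero_of_killedBy (h : j + k = n) (b : OrthonormalBasis (Fin n) ℝ V)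
    {α : Alt j V} {m : V} (hm : m ≠ 0) (hα : KilledBy α m) (v : Fin k → V)
    (hv : ∀ i, ⟪m, v i⟫ = 0) : hodgeStar h b α v = 0 := by
  have h1 := factorial_mul_hodgeStar_apply h b α v
  -- As `α` ignores components along `m`, the projection may be inserted into `α`. Self-adjointness
  -- moves it to the volume form, all of whose arguments are then orthogonal to `m`.
  have h2 := sum_comp_symmetric b (projAway_isSymmetric m) α.toMultilinearMap (volLeft h b v)
  have h3 : ∑ σ : Fin j → Fin n, α (b ∘ σ) * volForm h b (Sum.elim (b ∘ σ) v) = 0 := by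
    refine Eq.trans ?_ (h2.trans (Finset.sum_eq_zero fun σ _ => ?_))
    · refine Finset.sum_congr rfl fun σ _ => ?_
      exact congrArg (· * _) (hα.comp_projAway (b ∘ σ)).symm
    · have : volLeft h b v (projAway m ∘ b ∘ σ) = 0 := by
        refine volForm_eq_zero_of_inner_eq_zero h b hm _ ?_
        rintro (i | i)
        · exact inner_projAway hm _
        · exact hv i
      rw [this, mul_zero]
  rw [h3] at h1
  exact (mul_eq_zero.1 h1).resolve_left (by positivity)

/-- If `α` vanishes on tuples orthogonal to `m`, then `⋆ α` is killed by `m`. -/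
theorem killedBy_hodgeStar (h : j + k = n) (b : OrthonormalBasis (Fin n) ℝ V)
    {α : Alt j V} {m : V} (hm : m ≠ 0) (hα : ∀ v : Fin j → V, (∀ i, ⟪m, v i⟫ = 0) → α v = 0) :
    KilledBy (hodgeStar h b α) m := by
  rintro v ⟨i₀, hi₀⟩
  have h1 := factorial_mul_hodgeStar_apply h b α v
  -- The mirror argument: the volume form already has `m` as an argument, so the projection may be
  -- inserted there and moved to `α`.
  have h2 := sum_comp_symmetric b (projAway_isSymmetric m) α.toMultilinearMap (volLeft h b v)
  have h3 : ∑ σ : Fin j → Fin n, α (b ∘ σ) * volForm h b (Sum.elim (b ∘ σ) v) = 0 := by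
    refine Eq.trans ?_ (h2.symm.trans (Finset.sum_eq_zero fun σ _ => ?_))
    · refine Finset.sum_congr rfl fun σ _ => congrArg (α (b ∘ σ) * ·) ?_
      change volLeft h b v (b ∘ σ) = volLeft h b v (projAway m ∘ b ∘ σ)
      -- A multiple of `m` in the first group repeats the argument `v i₀ = m`.
      have hk : ∀ c : ℝ, ∀ u : Fin j → V, ∀ i, u i = c • m → volLeft h b v u = 0 := by
        intro c u i hu
        have h5 := (volLeft h b v).map_update_smul u i c m
        rw [← hu, Function.update_eq_self] at h5
        rw [h5]
        have : volLeft h b v (Function.update u i m) = 0 :=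
          (volForm h b).map_eq_zero_of_eq _ (i := Sum.inl i) (j := Sum.inr i₀)
            (by simp [hi₀]) (by simp)
        rw [this, smul_zero]
      have key : ∀ (s : Finset (Fin j)) (u : Fin j → V),
          volLeft h b v (s.piecewise (projAway m ∘ u) u) = volLeft h b v u := by
        intro s u
        induction s using Finset.induction_on with
        | empty => simp
        | insert a s ha ih =>
          rw [Finset.piecewise_insert, ← ih, Function.comp_apply, projAway_apply, sub_eq_add_neg,
            ← neg_smul, (volLeft h b v).map_update_add,
            hk (-((⟪m, m⟫)⁻¹ * ⟪m, u a⟫)) (Function.update _ a (_ • m)) a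
              (Function.update_self ..), add_zero]
          congr 1
          rw [Function.update_eq_self_iff]
          simp [ha]
      simpa using (key Finset.univ (b ∘ σ)).symm
    · have : α.toMultilinearMap (projAway m ∘ b ∘ σ) = 0 := hα _ fun i => inner_projAway hm _
      rw [this, zero_mul]
  rw [h3] at h1
  exact (mul_eq_zero.1 h1).resolve_left (by positivity)

end Hodge

end BubbleForms

namespace BubbleForms

/-! ### Splitting alternating forms by the label sets of tuples of basis vectors. -/

section Support

variable {V ι κ : Type*} [AddCommGroup V] [Module ℝ V] [DecidableEq κ] {k : ℕ}

/-- The labels that occur in a tuple of indices. -/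
def labelSupport (lab : ι → Option κ) (r : Fin k → ι) : Finset κ :=
  Finset.univ.biUnion fun x => (lab (r x)).toFinset

theorem mem_labelSupport {lab : ι → Option κ} {r : Fin k → ι} {i : κ} :
    i ∈ labelSupport lab r ↔ ∃ x, lab (r x) = some i := by
  simp [labelSupport]

/-- The forms that vanish on all tuples of basis vectors whose set of labels is not `F`. -/
def supportedForms (B : Module.Basis ι ℝ V) (lab : ι → Option κ) (k : ℕ) (F : Finset κ) :
    Submodule ℝ (Alt k V) where
  carrier := {ω | ∀ r : Fin k → ι, labelSupport lab r ≠ F → ω (B ∘ r) = 0}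
  add_mem' hω hη r hr := by rw [AlternatingMap.add_apply, hω r hr, hη r hr, add_zero]
  zero_mem' _ _ := rfl
  smul_mem' c ω hω r hr := by rw [AlternatingMap.smul_apply, hω r hr, smul_zero]

theorem iSupIndep_supportedForms (B : Module.Basis ι ℝ V) (lab : ι → Option κ) :
    iSupIndep (supportedForms B lab k) := by
  rw [iSupIndep_iff_finsetSum_eq_zero_imp_eq_zero]
  intro s ω hω hsum F hF
  refine B.ext_alternating fun r _ => ?_
  by_cases hr : labelSupport lab r = F
  · let ev : Alt k V →+ ℝ := ⟨⟨fun η => η (B ∘ r), rfl⟩, fun _ _ => rfl⟩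
    have h1 : ∑ G ∈ s, ev (ω G) = 0 := (map_sum ev _ _).symm.trans (by rw [hsum, map_zero])
    exact (Finset.sum_eq_single_of_mem (f := fun G => ev (ω G)) F hF fun G hG hne =>
      hω G hG r fun hc => hne (hc.symm.trans hr)).symm.trans h1
  · exact hω F hF r hr

/-- Pulling `ω` back along the map that drops the basis vectors with label outside `G` keeps the
tuples with label set contained in `G`. The parts for proper subsets, known by induction, are
subtracted. -/
theorem exists_support_projection (B : Module.Basis ι ℝ V) (lab : ι → Option κ) (ω : Alt k V)
    (G : Finset κ) : ∃ η : Alt k V, ∀ r : Fin k → ι,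
      η (B ∘ r) = if labelSupport lab r = G then ω (B ∘ r) else 0 := by
  classical
  induction G using Finset.strongInduction with
  | H G ih =>
    choose! η hη using ih
    let L : V →ₗ[ℝ] V := B.constr ℝ fun x => if (lab x).toFinset ⊆ G then B x else 0
    refine ⟨ω.compLinearMap L - ∑ F ∈ G.ssubsets, η F, fun r => ?_⟩
    let ev : Alt k V →+ ℝ := ⟨⟨fun η => η (B ∘ r), rfl⟩, fun _ _ => rfl⟩
    have h1 : (∑ F ∈ G.ssubsets, η F) (B ∘ r) =
        ∑ F ∈ G.ssubsets, if labelSupport lab r = F then ω (B ∘ r) else 0 := by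
      refine (map_sum ev _ _).trans (Finset.sum_congr rfl fun F hF => ?_)
      exact hη F (Finset.mem_ssubsets.1 hF) r
    have h2 : ω.compLinearMap L (B ∘ r) =
        if labelSupport lab r ⊆ G then ω (B ∘ r) else 0 := by
      rw [AlternatingMap.compLinearMap_apply]
      split_ifs with h
      · congr 1
        funext x
        simp only [L, Function.comp_apply, Module.Basis.constr_basis]
        exact if_pos fun i hi => h (mem_labelSupport.2 ⟨x, by simpa using hi⟩)
      · obtain ⟨i, hi, hiG⟩ := Finset.not_subset.1 h
        obtain ⟨x, hx⟩ := mem_labelSupport.1 hi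
        refine ω.map_coord_zero x ?_
        simp only [L, Function.comp_apply, Module.Basis.constr_basis]
        exact if_neg fun hc => hiG (hc (by simp [hx]))
    rw [AlternatingMap.sub_apply, h1, h2, Finset.sum_ite_eq]
    simp only [Finset.mem_ssubsets]
    by_cases hG : labelSupport lab r = G
    · simp [hG]
    · by_cases hs : labelSupport lab r ⊆ G
      · simp [hG, hs, Finset.ssubset_iff_subset_ne]
      · simp [hG, hs, Finset.ssubset_iff_subset_ne]

theorem isDirectSum_supportedForms [Fintype κ] (B : Module.Basis ι ℝ V) (lab : ι → Option κ) :
    IsDirectSum ⊤ (supportedForms B lab k) := by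
  refine ⟨iSupIndep_supportedForms B lab, eq_top_iff.2 fun ω _ => ?_⟩
  choose η hη using exists_support_projection B lab ω
  have h1 : ω = ∑ F, η F := by
    refine B.ext_alternating fun r _ => ?_
    let ev : Alt k V →+ ℝ := ⟨⟨fun η => η (B ∘ r), rfl⟩, fun _ _ => rfl⟩
    have h2 : ev (∑ F, η F) = ω (B ∘ r) := by
      rw [map_sum]
      refine (Finset.sum_congr rfl fun F _ => hη F r).trans ?_
      simp
    exact h2.symm
  rw [h1]
  refine Submodule.sum_mem _ fun F _ => Submodule.mem_iSup_of_mem F fun r hr => ?_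
  rw [hη, if_neg hr]

theorem exists_injective_of_supportedForms_ne_bot {B : Module.Basis ι ℝ V} {lab : ι → Option κ}
    {F : Finset κ} (h : supportedForms B lab k F ≠ ⊥) :
    ∃ r : Fin k → ι, Function.Injective r ∧ labelSupport lab r = F := by
  contrapose! h
  refine (Submodule.eq_bot_iff _).2 fun ω hω => B.ext_alternating fun r hr => ?_
  exact hω r (h r hr)

end Support

open scoped RealInnerProductSpace

/-! ### Dual bases adapted to a subspace. -/

section Frame

variable {W : Type*} [NormedAddCommGroup W] [InnerProductSpace ℝ W]

/-- A pair of dual bases `vec`, `dual` of `W` that is adapted to a subspace `E`: the vectors without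
label form an orthonormal basis of `E`, and those with a label are orthogonal to `E`. -/
structure AdaptedFrame (E : Submodule ℝ W) (ι κ : Type*) where
  vec : ι → W
  dual : Module.Basis ι ℝ W
  lab : ι → Option κ
  inner_dual_self : ∀ x, ⟪vec x, dual x⟫ = 1
  inner_dual_of_ne : ∀ x y, x ≠ y → ⟪vec x, dual y⟫ = 0
  lab_inj : ∀ x y i, lab x = some i → lab y = some i → x = y
  span_none : Submodule.span ℝ (vec '' {x | lab x = none}) = E
  dual_none : ∀ x, lab x = none → dual x = vec x
  vec_mem_orthogonal : ∀ x, lab x ≠ none → vec x ∈ Eᗮ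

variable {E : Submodule ℝ W} {ι κ : Type*} {k : ℕ}

namespace AdaptedFrame

variable (φ : AdaptedFrame E ι κ)

/-- The span of the unlabelled vectors and the vectors with label in `F`. -/
def spanOf (F : Finset κ) : Submodule ℝ W :=
  Submodule.span ℝ (φ.vec '' {x | φ.lab x = none ∨ ∃ i ∈ F, φ.lab x = some i})

theorem sum_inner_smul_dual [Fintype ι] (v : W) : ∑ x, ⟪φ.vec x, v⟫ • φ.dual x = v := by
  classical
  have h : ∀ x, ⟪φ.vec x, v⟫ = φ.dual.repr v x := by
    intro x
    conv_lhs => rw [← φ.dual.sum_repr v]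
    rw [inner_sum, Finset.sum_eq_single_of_mem x (Finset.mem_univ x)]
    · rw [real_inner_smul_right, φ.inner_dual_self, mul_one]
    · intro y _ hy
      rw [real_inner_smul_right, φ.inner_dual_of_ne x y hy.symm, mul_zero]
  simp only [h, φ.dual.sum_repr]

theorem eq_zero_of_inner_dual [Fintype ι] (v : W) (h : ∀ x, ⟪φ.dual x, v⟫ = 0) : v = 0 := by
  have h1 : ⟪∑ x, ⟪φ.vec x, v⟫ • φ.dual x, v⟫ = 0 := by
    rw [sum_inner]
    exact Finset.sum_eq_zero fun x _ => by rw [real_inner_smul_left, h, mul_zero]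
  rw [sum_inner_smul_dual] at h1
  exact inner_self_eq_zero.1 h1

theorem sum_inner_smul_vec [Fintype ι] (v : W) : ∑ x, ⟪φ.dual x, v⟫ • φ.vec x = v := by
  refine (sub_eq_zero.1 (φ.eq_zero_of_inner_dual _ fun y => ?_)).symm
  rw [inner_sub_right, inner_sum, Finset.sum_eq_single_of_mem y (Finset.mem_univ y)]
  · rw [real_inner_smul_right, real_inner_comm (φ.vec y), φ.inner_dual_self, mul_one, sub_self]
  · intro x _ hx
    rw [real_inner_smul_right, real_inner_comm (φ.vec x), φ.inner_dual_of_ne x y hx, mul_zero]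

theorem apply_eq_sum [Fintype ι] [DecidableEq ι] (ω : Alt k W) (v : Fin k → W) :
    ω v = ∑ r : Fin k → ι, (∏ i, ⟪φ.vec (r i), v i⟫) * ω (φ.dual ∘ r) := by
  have h1 : v = fun i => ∑ x, ⟪φ.vec x, v i⟫ • φ.dual x := by
    funext i
    rw [sum_inner_smul_dual]
  conv_lhs => rw [h1]
  refine (ω.toMultilinearMap.map_sum _).trans (Finset.sum_congr rfl fun r _ => ?_)
  exact ω.toMultilinearMap.map_smul_univ _ _

theorem le_spanOf (F : Finset κ) : E ≤ φ.spanOf F := by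
  conv_lhs => rw [← φ.span_none]
  exact Submodule.span_mono (Set.image_mono fun x hx => Or.inl hx)

theorem mem_orthogonal_spanOf {F : Finset κ} {y : W}
    (h : ∀ x, (φ.lab x = none ∨ ∃ i ∈ F, φ.lab x = some i) → ⟪φ.vec x, y⟫ = 0) :
    y ∈ (φ.spanOf F)ᗮ := by
  rw [Submodule.mem_orthogonal]
  intro u hu
  induction hu using Submodule.span_induction with
  | mem u hu => obtain ⟨x, hx, rfl⟩ := hu; exact h x hx
  | zero => simp
  | add x y _ _ hx hy => rw [inner_add_left, hx, hy, add_zero]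
  | smul c x _ hx => rw [real_inner_smul_left, hx, mul_zero]

/-- The coefficient of `m` at `vec x` is its product with `dual x`. For unlabelled `x` this vanishes
because `dual x` lies in `E`; for a label outside `F`, because `dual x` is orthogonal to `spanOf F`.
-/
theorem mem_span_of_mem_spanOf [Fintype ι] {F : Finset κ} {m : W}
    (hm : m ∈ φ.spanOf F) (hmE : m ∈ Eᗮ) :
    m ∈ Submodule.span ℝ (φ.vec '' {x | ∃ i ∈ F, φ.lab x = some i}) := by
  rw [← φ.sum_inner_smul_vec m]
  refine Submodule.sum_mem _ fun x _ => ?_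
  by_cases hx : ∃ i ∈ F, φ.lab x = some i
  · exact Submodule.smul_mem _ _ (Submodule.subset_span ⟨x, hx, rfl⟩)
  · have h0 : ⟪φ.dual x, m⟫ = 0 := by
      by_cases hn : φ.lab x = none
      · rw [φ.dual_none x hn]
        refine (Submodule.mem_orthogonal _ _).1 hmE _ ?_
        exact φ.span_none.le (Submodule.subset_span ⟨x, hn, rfl⟩)
      · have : φ.dual x ∈ (φ.spanOf F)ᗮ := φ.mem_orthogonal_spanOf fun y hy =>
          φ.inner_dual_of_ne y x fun hc => (hc ▸ hy).elim hn hx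
        exact (Submodule.mem_orthogonal' _ _).1 this m hm
    rw [h0, zero_smul]
    exact Submodule.zero_mem _

end AdaptedFrame

end Frame

/-! ### Images of the Hodge star of a subspace. -/

section Star

variable {W : Type*} [NormedAddCommGroup W] [InnerProductSpace ℝ W] [FiniteDimensional ℝ W]
  {n j k : ℕ}

/-- Pull-back of forms on a subspace along the orthogonal projection. -/
noncomputable def extendForm (k : ℕ) (U : Submodule ℝ W) : Alt k U →ₗ[ℝ] Alt k W :=
  pullback k U.orthogonalProjectionOnto.toLinearMap

/-- Restriction of forms to a subspace. -/
noncomputable def restrictForm (k : ℕ) (U : Submodule ℝ W) : Alt k W →ₗ[ℝ] Alt k U :=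
  pullback k U.subtype

/-- The image of the forms on `E` under the Hodge star of `U`. -/
noncomputable def starImage (h : j + k = n) (U E : Submodule ℝ W)
    (b : OrthonormalBasis (Fin n) ℝ U) : Submodule ℝ (Alt k W) :=
  (LinearMap.range (extendForm j E)).map
    (extendForm k U ∘ₗ hodgeStar h b ∘ₗ restrictForm j U)

theorem extendForm_killedBy (U : Submodule ℝ W) (a : Alt k U) {m : W} (hm : m ∈ Uᗮ) :
    KilledBy (extendForm k U a) m := by
  rintro v ⟨i, rfl⟩
  refine a.map_coord_zero i ?_
  exact Submodule.orthogonalProjectionOnto_apply_of_mem_orthogonal hm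

theorem extendForm_restrictForm {U : Submodule ℝ W} {ω : Alt k W}
    (h : ∀ m ∈ Uᗮ, KilledBy ω m) : extendForm k U (restrictForm k U ω) = ω := by
  ext v
  refine eq_of_forall_killedBy_sub (ω := ω)
    (v := fun i => ((U.orthogonalProjectionOnto (v i) : U) : W)) (w := v) fun i => h _ ?_
  rw [← neg_sub]
  exact Submodule.neg_mem _ (Submodule.sub_starProjection_mem_orthogonal (K := U) (v i))

theorem killedBy_of_mem_starImage {h : j + k = n} {U E : Submodule ℝ W}
    {b : OrthonormalBasis (Fin n) ℝ U} {ω : Alt k W} (hω : ω ∈ starImage h U E b) {m : W}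
    (hm : m ∈ Uᗮ) : KilledBy ω m := by
  obtain ⟨_, -, rfl⟩ := hω
  exact extendForm_killedBy U _ hm

/-- A form extended from `E` is killed by vectors orthogonal to `E`, and the star of `U` turns this
into vanishing on tuples orthogonal to `m`. -/
theorem apply_eq_zero_of_mem_starImage {h : j + k = n} {U E : Submodule ℝ W}
    {b : OrthonormalBasis (Fin n) ℝ U} {ω : Alt k W} (hω : ω ∈ starImage h U E b) {m : W}
    (hm : m ∈ U) (hmE : m ∈ Eᗮ) (hm0 : m ≠ 0) {v : Fin k → W} (hv : ∀ i, ⟪m, v i⟫ = 0) :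
    ω v = 0 := by
  obtain ⟨_, ⟨a, rfl⟩, rfl⟩ := hω
  refine hodgeStar_apply_eq_zero_of_killedBy h b (m := (⟨m, hm⟩ : U)) ?_ ?_ _ fun i => ?_
  · simpa using hm0
  · rintro u ⟨i, hi⟩
    exact extendForm_killedBy E a hmE _ ⟨i, by rw [hi]; rfl⟩
  · rw [← hv i]
    exact Submodule.inner_orthogonalProjectionOnto_eq_of_mem_left (K := U) ⟨m, hm⟩ (v i)

/-- The preimage is, up to sign, the star `β` of `ω` itself. The vanishing conditions on `ω` say
that `β` is killed by `S`, hence by all of `U ∩ Eᗮ`, so `β` is extended from `E`. -/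
theorem mem_starImage (h : j + k = n) {U E : Submodule ℝ W} (hE : E ≤ U)
    (b : OrthonormalBasis (Fin n) ℝ U) {ω : Alt k W} (hω : ∀ m ∈ Uᗮ, KilledBy ω m)
    (S : Set W) (hS : ∀ m ∈ S, m ∈ U ∧ m ≠ 0) (hspan : ∀ m ∈ U, m ∈ Eᗮ → m ∈ Submodule.span ℝ S)
    (hv : ∀ m ∈ S, ∀ v : Fin k → W, (∀ i, ⟪m, v i⟫ = 0) → ω v = 0) :
    ω ∈ starImage h U E b := by
  have h' : k + j = n := by omega
  obtain ⟨c, hc, hstar⟩ := exists_hodgeStar_hodgeStar h' h b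
  set β : Alt j U := hodgeStar h' b (restrictForm k U ω) with hβ
  have hkill : ∀ m : U, (m : W) ∈ Eᗮ → KilledBy β m := by
    intro m hm
    have h1 : ∀ s : U, (s : W) ∈ S → KilledBy β s := by
      intro s hs
      refine killedBy_hodgeStar h' b (by simpa using (hS s hs).2) fun v hv' => ?_
      exact hv s hs (fun i => v i) hv'
    refine KilledBy.of_mem_span (S := (fun x : U => (x : W)) ⁻¹' S) h1 ?_
    have h2 := hspan m m.2 hm
    have h3 : S = U.subtype '' ((fun x : U => (x : W)) ⁻¹' S) := by
      ext x
      constructor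
      · exact fun hx => ⟨⟨x, (hS x hx).1⟩, hx, rfl⟩
      · rintro ⟨y, hy, rfl⟩
        exact hy
    rw [h3, Submodule.span_image] at h2
    obtain ⟨y, hy, hym⟩ := h2
    rwa [← Subtype.ext hym]
  have hext : restrictForm j U (extendForm j E (pullback j (Submodule.inclusion hE) β)) = β := by
    ext v
    refine eq_of_forall_killedBy_sub (ω := β)
      (v := fun i => Submodule.inclusion hE (E.orthogonalProjectionOnto (v i : W))) (w := v)
      fun i => hkill _ ?_
    rw [← neg_sub]
    exact Submodule.neg_mem _ (Submodule.sub_starProjection_mem_orthogonal (K := E) (v i : W))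
  -- The factor `c` cancels the sign of the double star, since `c * c = 1`.
  refine ⟨extendForm j E (pullback j (Submodule.inclusion hE) (c • β)), ⟨_, rfl⟩, ?_⟩
  simp only [LinearMap.comp_apply, map_smul, hext]
  rw [hβ, hstar, map_smul, smul_smul, hc, one_smul, extendForm_restrictForm hω]

variable {E : Submodule ℝ W} {ι κ : Type*} [Fintype ι] [DecidableEq κ]

/-- A dual vector with label outside `F` is orthogonal to `U` and kills the form. If a label `i ∈ F`
is missing, the whole tuple is orthogonal to the frame vector labelled `i`, which lies in `U ∩ Eᗮ`.
Conversely, expanding in the frame leaves only tuples with label set `F`, and each of their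
coefficients has a zero factor under either condition of `mem_starImage`. -/
theorem starImage_eq_supportedForms (φ : AdaptedFrame E ι κ) (h : j + k = n) {U : Submodule ℝ W}
    {F : Finset κ} (hU : U = φ.spanOf F) (b : OrthonormalBasis (Fin n) ℝ U)
    (hF : ∀ i ∈ F, ∃ x, φ.lab x = some i) :
    starImage h U E b = supportedForms φ.dual φ.lab k F := by
  classical
  have hvec : ∀ x, φ.vec x ≠ 0 := by
    intro x hx
    have := φ.inner_dual_self x
    simp [hx] at this
  ext ω
  constructor
  · intro hω r hr
    by_cases hsub : labelSupport φ.lab r ⊆ F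
    · have : ¬ F ⊆ labelSupport φ.lab r := fun hc => hr (hsub.antisymm hc)
      obtain ⟨i, hi, hir⟩ := Finset.not_subset.1 this
      obtain ⟨x, hx⟩ := hF i hi
      refine apply_eq_zero_of_mem_starImage hω (m := φ.vec x) ?_
        (φ.vec_mem_orthogonal x (by simp [hx])) (hvec x) fun y => ?_
      · rw [hU]
        exact Submodule.subset_span ⟨x, Or.inr ⟨i, hi, hx⟩, rfl⟩
      · exact φ.inner_dual_of_ne _ _ fun hc => hir (mem_labelSupport.2 ⟨y, hc ▸ hx⟩)
    · obtain ⟨i, hi, hiF⟩ := Finset.not_subset.1 hsub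
      obtain ⟨x, hx⟩ := mem_labelSupport.1 hi
      refine killedBy_of_mem_starImage hω (m := φ.dual (r x)) ?_ _ ⟨x, rfl⟩
      rw [hU]
      refine φ.mem_orthogonal_spanOf fun y hy => φ.inner_dual_of_ne _ _ fun hc => ?_
      rw [hc, hx] at hy
      simp [hiF] at hy
  · intro hω
    refine mem_starImage h (hU ▸ φ.le_spanOf F) b ?_
      (φ.vec '' {x | ∃ i ∈ F, φ.lab x = some i}) ?_ ?_ ?_
    · rintro m hm v ⟨x, hx⟩
      rw [φ.apply_eq_sum]
      refine Finset.sum_eq_zero fun r _ => ?_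
      by_cases hr : labelSupport φ.lab r = F
      · rw [Finset.prod_eq_zero (Finset.mem_univ x), zero_mul]
        rw [hx]
        refine (Submodule.mem_orthogonal _ _).1 hm _ ?_
        rw [hU]
        refine Submodule.subset_span ⟨r x, ?_, rfl⟩
        cases hl : φ.lab (r x) with
        | none => exact Or.inl hl
        | some i => exact Or.inr ⟨i, hr ▸ mem_labelSupport.2 ⟨x, hl⟩, hl⟩
      · rw [hω r hr, mul_zero]
    · rintro _ ⟨x, ⟨i, hi, hx⟩, rfl⟩
      refine ⟨?_, hvec x⟩
      rw [hU]
      exact Submodule.subset_span ⟨x, Or.inr ⟨i, hi, hx⟩, rfl⟩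
    · rw [hU]
      exact fun m hm hmE => φ.mem_span_of_mem_spanOf hm hmE
    · rintro _ ⟨x, ⟨i, hi, hx⟩, rfl⟩ v hv
      rw [φ.apply_eq_sum]
      refine Finset.sum_eq_zero fun r _ => ?_
      by_cases hr : labelSupport φ.lab r = F
      · rw [← hr] at hi
        obtain ⟨y, hy⟩ := mem_labelSupport.1 hi
        rw [Finset.prod_eq_zero (Finset.mem_univ y), zero_mul]
        rw [φ.lab_inj _ _ _ hy hx]
        exact hv y
      · rw [hω r hr, mul_zero]

/-- In top degree every form is in the image of the Hodge star. -/
theorem starImage_eq_range (h : j + k = n) (hk : k = n) {U E : Submodule ℝ W} (hE : E ≤ U)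
    (b : OrthonormalBasis (Fin n) ℝ U) :
    starImage h U E b = LinearMap.range (extendForm k U) := by
  refine le_antisymm ?_ ?_
  · rintro _ ⟨_, -, rfl⟩
    exact ⟨_, rfl⟩
  · rintro _ ⟨a, rfl⟩
    refine mem_starImage h hE b (fun m hm => extendForm_killedBy U a hm)
      {m | m ∈ U ∧ m ≠ 0} (fun m hm => hm) (fun m hm _ => ?_) ?_
    · by_cases h0 : m = 0
      · rw [h0]; exact Submodule.zero_mem _
      · exact Submodule.subset_span ⟨hm, h0⟩
    · rintro m ⟨hm, hm0⟩ v hv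
      -- Were the `k = n` projected vectors independent, they would span `U`, and the nonzero `m ∈
      -- U` would be orthogonal to all of `U`.
      refine AlternatingMap.map_linearDependent a _ fun hli => ?_
      subst hk
      have hspan := hli.span_eq_top_of_card_eq_finrank'
        (by simp [Module.finrank_eq_card_basis b.toBasis])
      have h1 : (⟨m, hm⟩ : U) ∈ (⊤ : Submodule ℝ U)ᗮ := by
        rw [← hspan, Submodule.mem_orthogonal]
        intro u hu
        induction hu using Submodule.span_induction with
        | mem u hu =>
          obtain ⟨i, rfl⟩ := hu
          rw [real_inner_comm, ← hv i]
          exact Submodule.inner_orthogonalProjectionOnto_eq_of_mem_left (K := U) ⟨m, hm⟩ (v i)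
        | zero => simp
        | add x y _ _ hx hy => rw [inner_add_left, hx, hy, add_zero]
        | smul c x _ hx => rw [real_inner_smul_left, hx, mul_zero]
      rw [Submodule.top_orthogonal_eq_bot, Submodule.mem_bot] at h1
      exact hm0 (congrArg Subtype.val h1)

end Star

end BubbleForms

namespace BubbleForms

/-! ### Operations on internal direct sums. -/

section DirectSum

variable {M N I J K : Type*} [AddCommGroup M] [Module ℝ M] [AddCommGroup N] [Module ℝ N]

theorem iSup_pi_univ [Finite I] (B : J → I → Submodule ℝ M) :
    ⨆ i, Submodule.pi Set.univ (B i) = Submodule.pi Set.univ fun α => ⨆ i, B i α := by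
  classical
  simp only [← Submodule.iSup_map_single, Submodule.map_iSup]
  exact iSup_comm

theorem IsDirectSum.pi [Finite I] {B : J → I → Submodule ℝ M}
    (h : ∀ α, IsDirectSum ⊤ fun i => B i α) :
    IsDirectSum ⊤ fun i => Submodule.pi Set.univ (B i) := by
  constructor
  · rw [iSupIndep_iff_finsetSum_eq_zero_imp_eq_zero]
    intro s v hv hsum i hi
    funext α
    refine (iSupIndep_iff_finsetSum_eq_zero_imp_eq_zero _).1 (h α).1 s (fun i => v i α)
      (fun i hi => hv i hi α trivial) ?_ i hi
    rw [← Finset.sum_apply, hsum, Pi.zero_apply]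
  · rw [iSup_pi_univ, eq_top_iff]
    intro c _ α _
    change c α ∈ ⨆ i, B i α
    rw [(h α).2]
    trivial

theorem IsDirectSum.map {A : J → Submodule ℝ M} {W : Submodule ℝ M} (h : IsDirectSum W A)
    {Φ : M →ₗ[ℝ] N} (hΦ : Function.Injective Φ) :
    IsDirectSum (W.map Φ) fun i => (A i).map Φ := by
  constructor
  · rw [iSupIndep_iff_finsetSum_eq_zero_imp_eq_zero]
    intro s v hv hsum i hi
    choose! w hw hwv using hv
    have h1 : ∑ i ∈ s, w i = 0 := by
      apply hΦ
      rw [map_sum, map_zero, ← hsum]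
      exact Finset.sum_congr rfl hwv
    rw [← hwv i hi, (iSupIndep_iff_finsetSum_eq_zero_imp_eq_zero _).1 h.1 s w hw h1 i hi, map_zero]
  · rw [← Submodule.map_iSup, h.2]

/-- A direct sum decomposition may be reindexed, with zero summands added or removed. -/
theorem IsDirectSum.reindex {A : K → Submodule ℝ M} {W : Submodule ℝ M} (h : IsDirectSum W A)
    {B : J → Submodule ℝ M} (P : J → Prop) (g : J → K)
    (hinj : ∀ i j, P i → P j → g i = g j → i = j) (hB : ∀ i, P i → B i = A (g i))
    (hbot : ∀ i, ¬ P i → B i = ⊥) (hsurj : ∀ x, A x ≠ ⊥ → ∃ i, P i ∧ g i = x) :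
    IsDirectSum W B := by
  constructor
  · intro i
    by_cases hi : P i
    · rw [hB i hi]
      refine (h.1 (g i)).mono_right (iSup₂_le fun j hj => ?_)
      by_cases hPj : P j
      · rw [hB j hPj]
        exact le_iSup₂_of_le (g j) (fun hc => hj (hinj _ _ hPj hi hc)) le_rfl
      · rw [hbot j hPj]
        exact bot_le
    · rw [hbot i hi]
      exact disjoint_bot_left
  · rw [← h.2]
    apply le_antisymm
    · refine iSup_le fun j => ?_
      by_cases hj : P j
      · rw [hB j hj]
        exact le_iSup A (g j)
      · rw [hbot j hj]
        exact bot_le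
    · refine iSup_le fun x => ?_
      by_cases hx : A x = ⊥
      · rw [hx]
        exact bot_le
      · obtain ⟨i, hi, rfl⟩ := hsurj x hx
        rw [← hB i hi]
        exact le_iSup B i

/-- The summands of a direct sum may be grouped. -/
theorem IsDirectSum.group {L : J → Type*} {A : (Σ j, L j) → Submodule ℝ M} {W : Submodule ℝ M}
    (h : IsDirectSum W A) : IsDirectSum W fun j => ⨆ l, A ⟨j, l⟩ := by
  constructor
  · intro j
    have hd := h.1.disjoint_biSup_biSup (s := {p : Σ j, L j | p.1 = j})
      (t := {p : Σ j, L j | p.1 ≠ j}) (Set.disjoint_left.2 fun p hp hp' => hp' hp)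
    refine hd.mono ?_ ?_
    · exact iSup_le fun l => le_iSup₂_of_le (⟨j, l⟩ : Σ j, L j) rfl le_rfl
    · exact iSup₂_le fun j' hj' => iSup_le fun l =>
        le_iSup₂_of_le (⟨j', l⟩ : Σ j, L j) hj' le_rfl
  · rw [← h.2, iSup_sigma]

end DirectSum

/-! ### Vector-valued functions as families of coefficients. -/

section Tensor

variable {X M N I : Type*} [AddCommGroup M] [Module ℝ M] [AddCommGroup N] [Module ℝ N]

/-- The `M`-valued function with coefficients `c` with respect to scalar functions `m`. -/
noncomputable def combine [Fintype I] (m : I → X → ℝ) : (I → M) →ₗ[ℝ] (X → M) :=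
  LinearMap.pi fun x => ∑ α, m α x • LinearMap.proj α

theorem combine_apply [Fintype I] (m : I → X → ℝ) (c : I → M) (x : X) :
    combine m c x = ∑ α, m α x • c α := by
  simp [combine]

/-- Linear functionals separate the points of `M`, which reduces the claim to scalar coefficients.
-/
theorem combine_injective [Fintype I] {m : I → X → ℝ}
    (h : ∀ c : I → ℝ, (∀ x, ∑ α, c α * m α x = 0) → c = 0) :
    Function.Injective (combine m : (I → M) →ₗ[ℝ] (X → M)) := by
  rw [injective_iff_map_eq_zero]
  intro c hc
  funext α
  rw [Pi.zero_apply, ← Module.forall_dual_apply_eq_zero_iff ℝ]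
  intro ℓ
  refine congrFun (h (fun α => ℓ (c α)) fun x => ?_) α
  have h1 := congrArg ℓ (congrFun hc x)
  rw [combine_apply, map_sum, Pi.zero_apply, map_zero] at h1
  rw [← h1]
  exact Finset.sum_congr rfl fun α _ => by rw [map_smul, smul_eq_mul, mul_comm]

theorem smul_mem_tensor {P : Submodule ℝ (X → ℝ)} {A : Submodule ℝ M} {p : X → ℝ} {a : M}
    (hp : p ∈ P) (ha : a ∈ A) : (fun x => p x • a) ∈ tensor P A :=
  Submodule.subset_span ⟨p, hp, a, ha, rfl⟩

theorem map_combine_eq_tensor [Fintype I] (m : I → X → ℝ) (Q : I → Prop) [DecidablePred Q]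
    (A : Submodule ℝ M) :
    (Submodule.pi Set.univ fun α => if Q α then A else ⊥).map (combine m) =
      tensor (Submodule.span ℝ {p | ∃ α, Q α ∧ p = m α}) A := by
  classical
  apply le_antisymm
  · rintro _ ⟨c, hc, rfl⟩
    have h1 : combine m c = ∑ α, fun x => m α x • c α := by
      funext x
      rw [combine_apply, Finset.sum_apply]
    rw [h1]
    refine Submodule.sum_mem _ fun α _ => ?_
    have h2 : c α ∈ if Q α then A else ⊥ := hc α trivial
    by_cases hα : Q α
    · rw [if_pos hα] at h2
      exact smul_mem_tensor (Submodule.subset_span ⟨α, hα, rfl⟩) h2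
    · rw [if_neg hα, Submodule.mem_bot] at h2
      simp only [h2, smul_zero]
      exact Submodule.zero_mem _
  · refine Submodule.span_le.2 ?_
    rintro _ ⟨p, hp, a, ha, rfl⟩
    induction hp using Submodule.span_induction with
    | mem p hp =>
      obtain ⟨α, hα, rfl⟩ := hp
      refine ⟨Pi.single α a, fun β _ => ?_, ?_⟩
      · by_cases hβ : β = α
        · subst hβ
          simpa [hα] using ha
        · simp [hβ]
      · funext x
        rw [combine_apply, Finset.sum_eq_single_of_mem α (Finset.mem_univ α)]
        · simp
        · intro β _ hβ
          simp [hβ]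
    | zero =>
      simp only [Pi.zero_apply, zero_smul]
      exact Submodule.zero_mem _
    | add p q _ _ hp hq =>
      simp only [Pi.add_apply, add_smul]
      exact Submodule.add_mem _ hp hq
    | smul c p _ hp =>
      simp only [Pi.smul_apply, smul_assoc]
      exact Submodule.smul_mem _ c hp

theorem map_tensor (P : Submodule ℝ (X → ℝ)) (A : Submodule ℝ M) (g : X → ℝ) (S : M →ₗ[ℝ] N) :
    (tensor P A).map (LinearMap.pi fun x => g x • (S ∘ₗ LinearMap.proj x)) =
      tensor (P.map (LinearMap.mulLeft ℝ g)) (A.map S) := by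
  rw [tensor, Submodule.map_span, tensor]
  congr 1
  ext F
  constructor
  · rintro ⟨_, ⟨p, hp, a, ha, rfl⟩, rfl⟩
    refine ⟨_, ⟨p, hp, rfl⟩, _, ⟨a, ha, rfl⟩, ?_⟩
    funext x
    simp [smul_smul]
  · rintro ⟨_, ⟨p, hp, rfl⟩, _, ⟨a, ha, rfl⟩, rfl⟩
    refine ⟨_, ⟨p, hp, a, ha, rfl⟩, ?_⟩
    funext x
    simp [smul_smul]

end Tensor

/-! ### The Bernstein basis of the polynomials on the simplex. -/

section Monomials

variable {d : ℕ} (T : Affine.Simplex ℝ (EuclideanSpace ℝ (Fin d)) d)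

/-- The exponents of degree `r` in the barycentric coordinates. -/
abbrev Exponent (d r : ℕ) : Type :=
  {α : Fin (d + 1) → ℕ // α ∈ Finset.piAntidiag (Finset.univ : Finset (Fin (d + 1))) r}

theorem Exponent.sum_eq {d r : ℕ} (α : Exponent d r) : ∑ i, α.1 i = r :=
  (Finset.mem_piAntidiag.1 α.2).1

/-- The exponent with given entries. -/
def Exponent.mk {d r : ℕ} (α : Fin (d + 1) → ℕ) (h : ∑ i, α i = r) : Exponent d r :=
  ⟨α, Finset.mem_piAntidiag.2 ⟨h, fun i _ => Finset.mem_univ i⟩⟩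

/-- The indices with a nonzero entry. -/
def Exponent.supp {d r : ℕ} (α : Exponent d r) : Finset (Fin (d + 1)) :=
  Finset.univ.filter fun i => α.1 i ≠ 0

theorem Exponent.mem_supp {d r : ℕ} {α : Exponent d r} {i : Fin (d + 1)} :
    i ∈ α.supp ↔ α.1 i ≠ 0 := by
  simp [Exponent.supp]

theorem Exponent.supp_nonempty {d r : ℕ} (hr : 1 ≤ r) (α : Exponent d r) : α.supp.Nonempty := by
  by_contra h
  rw [Finset.not_nonempty_iff_eq_empty] at h
  have : ∑ i, α.1 i = 0 := Finset.sum_eq_zero fun i _ => by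
    by_contra hi
    have := Exponent.mem_supp.2 hi
    simp [h] at this
  rw [α.sum_eq] at this
  omega

/-- The monomials of degree `r` in the barycentric coordinates. -/
noncomputable def baryMonomial {r : ℕ} (α : Exponent d r) : body T → ℝ :=
  fun x => ∏ i, bary T i x ^ α.1 i

theorem sum_bary_smul (x : body T) : ∑ i, bary T i x • T.points i = x.1 :=
  (vertexBasis T).linear_combination_coord_eq_self x.1

theorem sum_bary (x : body T) : ∑ i, bary T i x = 1 :=
  (vertexBasis T).sum_coord_apply_eq_one x.1

theorem exists_bary_eq (w : Fin (d + 1) → ℝ) (hw : ∀ i, 0 ≤ w i) (hw1 : ∑ i, w i = 1) :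
    ∃ x : body T, ∀ i, bary T i x = w i := by
  refine ⟨⟨Finset.univ.affineCombination ℝ T.points w,
    affineCombination_mem_convexHull (fun i _ => hw i) hw1⟩, fun i => ?_⟩
  exact (vertexBasis T).coord_apply_combination_of_mem (Finset.mem_univ i) hw1

/-- The barycentric coordinates take all nonnegative values with sum 1. By homogeneity a relation on
`T` extends to all positive points, where a nonzero polynomial cannot vanish identically. -/
theorem baryMonomial_independent {r : ℕ} (c : Exponent d r → ℝ)
    (hc : ∀ x, ∑ α, c α * baryMonomial T α x = 0) : c = 0 := by
  classical
  let p : MvPolynomial (Fin (d + 1)) ℝ :=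
    ∑ α, MvPolynomial.monomial (Finsupp.equivFunOnFinite.symm α.1) (c α)
  have hp : p = 0 := by
    refine MvPolynomial.funext_set (fun _ => Set.Ioi (0 : ℝ)) (fun _ => Set.Ioi_infinite 0)
      fun y hy => ?_
    have hy' : ∀ i, 0 < y i := fun i => hy i trivial
    have hs : 0 < ∑ i, y i := Finset.sum_pos (fun i _ => hy' i) Finset.univ_nonempty
    obtain ⟨x, hx⟩ := exists_bary_eq T (fun i => y i / ∑ i, y i)
      (fun i => (div_pos (hy' i) hs).le) (by rw [← Finset.sum_div, div_self hs.ne'])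
    have h1 : ∀ α : Exponent d r, baryMonomial T α x = (∏ i, y i ^ α.1 i) / (∑ i, y i) ^ r := by
      intro α
      simp only [baryMonomial, hx, div_pow, Finset.prod_div_distrib, Finset.prod_pow_eq_pow_sum,
        α.sum_eq]
    have h2 := hc x
    simp only [h1, mul_div_assoc', ← Finset.sum_div] at h2
    rw [map_zero, map_sum]
    refine Eq.trans ?_ ((div_eq_zero_iff.1 h2).resolve_right (pow_pos hs r).ne')
    refine Finset.sum_congr rfl fun α _ => ?_
    rw [MvPolynomial.eval_monomial, Finsupp.prod_fintype _ _ (by simp)]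
    rfl
  funext α
  have h1 := congrArg (MvPolynomial.coeff (Finsupp.equivFunOnFinite.symm α.1)) hp
  simp only [p, MvPolynomial.coeff_sum, MvPolynomial.coeff_monomial, MvPolynomial.coeff_zero] at h1
  rw [Finset.sum_eq_single_of_mem α (Finset.mem_univ α)] at h1
  · simpa using h1
  · intro β _ hβ
    rw [if_neg]
    intro hc
    exact hβ (Subtype.ext (Finsupp.equivFunOnFinite.symm.injective hc))

theorem eval_bary_mem_span {r : ℕ} {H : MvPolynomial (Fin (d + 1)) ℝ} (hH : H.IsHomogeneous r) :
    (fun x : body T => MvPolynomial.eval (fun i => bary T i x) H) ∈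
      Submodule.span ℝ (Set.range (baryMonomial T : Exponent d r → _)) := by
  have h1 : (fun x : body T => MvPolynomial.eval (fun i => bary T i x) H) =
      ∑ β ∈ H.support, H.coeff β • fun x : body T => ∏ i, bary T i x ^ β i := by
    funext x
    rw [MvPolynomial.eval_eq', Finset.sum_apply]
    rfl
  rw [h1]
  refine Submodule.sum_mem _ fun β hβ => Submodule.smul_mem _ _ (Submodule.subset_span ?_)
  have h2 : ∑ i, β i = r := by
    rw [← hH (MvPolynomial.mem_support_iff.1 hβ), Finsupp.weight_apply,
      Finsupp.sum_fintype _ _ (by simp)]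
    simp
  exact ⟨Exponent.mk β h2, rfl⟩

theorem polyT_eq_span (r : ℕ) :
    polyT T r = Submodule.span ℝ (Set.range (baryMonomial T : Exponent d r → _)) := by
  apply le_antisymm
  · rintro _ ⟨p, hp, rfl⟩
    have hdeg : p.totalDegree ≤ r := (MvPolynomial.mem_restrictTotalDegree _ _ _).1 hp
    have h1 : (LinearMap.pi fun x : body T => (MvPolynomial.aeval (R := ℝ) (fun i => x.1 i) :
        MvPolynomial (Fin d) ℝ →ₐ[ℝ] ℝ).toLinearMap) p =
        ∑ β ∈ p.support, p.coeff β • fun x : body T => ∏ j, x.1 j ^ β j := by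
      funext x
      simp only [LinearMap.pi_apply, AlgHom.toLinearMap_apply, MvPolynomial.aeval_eq_eval,
        Finset.sum_apply]
      exact MvPolynomial.eval_eq' _ _
    rw [h1]
    refine Submodule.sum_mem _ fun β hβ => Submodule.smul_mem _ _ ?_
    have hβr : ∑ j, β j ≤ r := by
      refine le_trans ?_ hdeg
      have := MvPolynomial.le_totalDegree hβ
      rwa [Finsupp.sum_fintype _ _ (by simp)] at this
    -- Homogenization: each Cartesian coordinate is written linearly in the λ_i, and the missing
    -- degree is supplied by powers of Σ λ_i = 1.
    let H : MvPolynomial (Fin (d + 1)) ℝ :=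
      (∏ j, (∑ i, MvPolynomial.C (T.points i j) * MvPolynomial.X i) ^ β j) *
        (∑ i, MvPolynomial.X i) ^ (r - ∑ j, β j)
    have hH : H.IsHomogeneous r := by
      have ha : ∀ j, ((∑ i, MvPolynomial.C (T.points i j) * MvPolynomial.X i :
          MvPolynomial (Fin (d + 1)) ℝ) ^ β j).IsHomogeneous (β j) := by
        intro j
        have := (MvPolynomial.IsHomogeneous.sum Finset.univ
          (fun i => (MvPolynomial.C (T.points i j) * MvPolynomial.X i :
            MvPolynomial (Fin (d + 1)) ℝ)) 1
          (fun i _ => MvPolynomial.isHomogeneous_C_mul_X _ _)).pow (β j)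
        rwa [one_mul] at this
      have hb : ((∑ i, MvPolynomial.X i : MvPolynomial (Fin (d + 1)) ℝ) ^
          (r - ∑ j, β j)).IsHomogeneous (r - ∑ j, β j) := by
        have := (MvPolynomial.IsHomogeneous.sum Finset.univ
          (fun i => (MvPolynomial.X i : MvPolynomial (Fin (d + 1)) ℝ)) 1
          (fun i _ => MvPolynomial.isHomogeneous_X _ _)).pow (r - ∑ j, β j)
        rwa [one_mul] at this
      have := (MvPolynomial.IsHomogeneous.prod Finset.univ _ _ fun j _ => ha j).mul hb
      rwa [Nat.add_sub_cancel' hβr] at this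
    convert eval_bary_mem_span T hH using 1
    funext x
    have hx : ∀ j, x.1 j = ∑ i, T.points i j * bary T i x := by
      intro j
      conv_lhs => rw [← sum_bary_smul T x]
      simp [mul_comm]
    simp only [H, map_mul, map_prod, map_pow, map_sum, MvPolynomial.eval_C, MvPolynomial.eval_X,
      sum_bary, one_pow, mul_one, ← hx]
  · rw [Submodule.span_le]
    rintro _ ⟨α, rfl⟩
    -- λ_i in Cartesian coordinates: its linear part on the standard basis plus its value at the
    -- origin.
    let L : Fin (d + 1) → MvPolynomial (Fin d) ℝ := fun i =>
      ∑ j, MvPolynomial.C (((vertexBasis T).coord i).linear (EuclideanSpace.single j 1)) *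
        MvPolynomial.X j + MvPolynomial.C ((vertexBasis T).coord i 0)
    refine ⟨∏ i, L i ^ α.1 i, (MvPolynomial.mem_restrictTotalDegree _ _ _).2 ?_, ?_⟩
    · have hL : ∀ i, (L i).totalDegree ≤ 1 := by
        intro i
        refine (MvPolynomial.totalDegree_add _ _).trans (max_le ?_ (by simp))
        refine MvPolynomial.totalDegree_finsetSum_le fun j _ => ?_
        refine (MvPolynomial.totalDegree_mul _ _).trans ?_
        rw [MvPolynomial.totalDegree_C, MvPolynomial.totalDegree_X]
      refine (MvPolynomial.totalDegree_finsetProd _ _).trans ?_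
      refine le_trans (Finset.sum_le_sum fun i _ => ?_) α.sum_eq.le
      refine (MvPolynomial.totalDegree_pow _ _).trans ?_
      exact (Nat.mul_le_mul_left _ (hL i)).trans (mul_one _).le
    · funext x
      simp only [LinearMap.pi_apply, AlgHom.toLinearMap_apply, map_prod, map_pow, baryMonomial]
      refine Finset.prod_congr rfl fun i _ => congrArg (· ^ α.1 i) ?_
      have h1 : bary T i x = ((vertexBasis T).coord i).linear x.1 + (vertexBasis T).coord i 0 := by
        have := ((vertexBasis T).coord i).map_vadd 0 x.1
        simpa [bary] using this
      have h2 : x.1 = ∑ j, x.1 j • EuclideanSpace.single j (1 : ℝ) := by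
        ext l
        simp [Finset.sum_apply, Pi.single_apply]
      rw [h1]
      conv_rhs => rw [h2]
      simp [L, mul_comm]

end Monomials

end BubbleForms

namespace BubbleForms

open scoped RealInnerProductSpace

/-! ### The frame adapted to a face. -/

section Geometry

variable {d : ℕ} (T : Affine.Simplex ℝ (EuclideanSpace ℝ (Fin d)) d)

theorem Face.card_eq (e : Face d) : e.1.card = e.dim + 1 := by
  have := Finset.card_pos.2 e.2
  unfold Face.dim
  omega

theorem tangent_mono {e f : Face d} (h : e.1 ⊆ f.1) : tangent T e ≤ tangent T f :=
  vectorSpan_mono ℝ (Set.image_mono (Finset.coe_subset.2 h))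

theorem sub_mem_tangent {f : Face d} {i j : Fin (d + 1)} (hi : i ∈ f.1) (hj : j ∈ f.1) :
    T.points i - T.points j ∈ tangent T f :=
  vsub_mem_vectorSpan ℝ (Set.mem_image_of_mem _ hi) (Set.mem_image_of_mem _ hj)

theorem tangent_le {f : Face d} {j : Fin (d + 1)} (hj : j ∈ f.1)
    {U : Submodule ℝ (EuclideanSpace ℝ (Fin d))}
    (h : ∀ i ∈ f.1, T.points i - T.points j ∈ U) : tangent T f ≤ U := by
  rw [tangent, vectorSpan_eq_span_vsub_set_right ℝ (Set.mem_image_of_mem T.points hj),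
    Submodule.span_le]
  rintro _ ⟨_, ⟨i, hi, rfl⟩, rfl⟩
  exact h i hi

/-- The gradient of the barycentric coordinate `λ_i`. -/
noncomputable def baryGrad (i : Fin (d + 1)) : EuclideanSpace ℝ (Fin d) :=
  (InnerProductSpace.toDual ℝ _).symm
    (LinearMap.toContinuousLinearMap ((vertexBasis T).coord i).linear)

theorem inner_baryGrad (i : Fin (d + 1)) (x : EuclideanSpace ℝ (Fin d)) :
    ⟪baryGrad T i, x⟫ = ((vertexBasis T).coord i).linear x :=
  InnerProductSpace.toDual_symm_apply

theorem inner_baryGrad_sub (i j l : Fin (d + 1)) :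
    ⟪baryGrad T i, T.points j - T.points l⟫ =
      (if i = j then 1 else 0) - (if i = l then 1 else 0) := by
  rw [inner_baryGrad, ← vsub_eq_sub, AffineMap.linearMap_vsub]
  exact congrArg₂ (· - ·) ((vertexBasis T).coord_apply i j) ((vertexBasis T).coord_apply i l)

theorem inner_baryGrad_of_mem_tangent {e : Face d} {i : Fin (d + 1)} (hi : i ∉ e.1)
    {x : EuclideanSpace ℝ (Fin d)} (hx : x ∈ tangent T e) : ⟪baryGrad T i, x⟫ = 0 := by
  obtain ⟨l, hl⟩ := e.2
  have hle : tangent T e ≤ LinearMap.ker ((vertexBasis T).coord i).linear := by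
    refine tangent_le T hl fun j hj => ?_
    rw [LinearMap.mem_ker, ← inner_baryGrad, inner_baryGrad_sub,
      if_neg fun h : i = j => hi (h ▸ hj), if_neg fun h : i = l => hi (h ▸ hl), sub_zero]
  rw [inner_baryGrad]
  exact hle hx

/-- The index type of the frame adapted to the face `e`. -/
abbrev FrameIndex (e : Face d) : Type := Fin e.dim ⊕ {i : Fin (d + 1) // i ∉ e.1}

/-- An orthonormal basis of the tangent space of `e`, together with the components orthogonal to `e`
of the edges from `e` to the other vertices. -/
noncomputable def frameVec (e : Face d) (b : OrthonormalBasis (Fin e.dim) ℝ (tangent T e)) :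
    FrameIndex e → EuclideanSpace ℝ (Fin d) :=
  Sum.elim (fun t => (b t : EuclideanSpace ℝ (Fin d))) fun i =>
    (T.points i.1 - T.points e.2.choose) -
      (tangent T e).starProjection (T.points i.1 - T.points e.2.choose)

/-- The dual family: the same orthonormal basis, together with the gradients of the barycentric
coordinates of the vertices off `e`. -/
noncomputable def frameDual (e : Face d) (b : OrthonormalBasis (Fin e.dim) ℝ (tangent T e)) :
    FrameIndex e → EuclideanSpace ℝ (Fin d) :=
  Sum.elim (fun t => (b t : EuclideanSpace ℝ (Fin d))) fun i => baryGrad T i.1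

variable (e : Face d) (b : OrthonormalBasis (Fin e.dim) ℝ (tangent T e))

theorem frameVec_inr_mem_orthogonal (i : {i : Fin (d + 1) // i ∉ e.1}) :
    frameVec T e b (Sum.inr i) ∈ (tangent T e)ᗮ :=
  Submodule.sub_starProjection_mem_orthogonal _

/-- For `i ∉ e` the gradient of λ_i is orthogonal to the tangent space of `e`, so projecting the
edges does not change their products with it; these are given by λ_i at the vertices. -/
theorem inner_frameVec_frameDual (x y : FrameIndex e) :
    ⟪frameVec T e b x, frameDual T e b y⟫ = if x = y then 1 else 0 := by
  classical
  rcases x with s | i <;> rcases y with t | l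
  · have := orthonormal_iff_ite.1 b.orthonormal s t
    simpa [frameVec, frameDual] using this
  · rw [if_neg (by simp), real_inner_comm]
    exact inner_baryGrad_of_mem_tangent T l.2 (b s).2
  · rw [if_neg (by simp)]
    exact (Submodule.mem_orthogonal' _ _).1 (frameVec_inr_mem_orthogonal T e b i) _ (b t).2
  · rw [real_inner_comm]
    simp only [frameVec, frameDual, Sum.elim_inr, inner_sub_right]
    rw [← inner_sub_right, inner_baryGrad_sub, inner_baryGrad_of_mem_tangent T l.2
      (Submodule.starProjection_apply_mem _ _), sub_zero,
      if_neg (fun h : l.1 = e.2.choose => l.2 (h ▸ e.2.choose_spec)), sub_zero]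
    simp [Subtype.ext_iff, eq_comm]

theorem frameDual_linearIndependent : LinearIndependent ℝ (frameDual T e b) := by
  classical
  rw [Fintype.linearIndependent_iff]
  intro c hc y
  have h := congrArg (fun z => ⟪frameVec T e b y, z⟫) hc
  simpa only [inner_sum, real_inner_smul_right, inner_frameVec_frameDual, inner_zero_right, mul_ite,
    mul_one, mul_zero, Finset.sum_ite_eq, Finset.mem_univ, if_true] using h

theorem card_frameIndex : Fintype.card (FrameIndex e) = d := by
  classical
  have h1 := e.card_eq
  have h2 : e.1.card ≤ d + 1 := by simpa using Finset.card_le_univ e.1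
  rw [Fintype.card_sum, Fintype.card_fin, Fintype.card_subtype_compl, Fintype.card_coe,
    Fintype.card_fin]
  omega

/-- The frame adapted to the tangent space of `e`, labelled by the vertices off `e`. -/
noncomputable def faceFrame : AdaptedFrame (tangent T e) (FrameIndex e) (Fin (d + 1)) where
  vec := frameVec T e b
  dual := Module.Basis.mk (frameDual_linearIndependent T e b)
    ((frameDual_linearIndependent T e b).span_eq_top_of_card_eq_finrank'
      (by rw [card_frameIndex, finrank_euclideanSpace_fin])).ge
  lab := Sum.elim (fun _ => none) fun i => some i.1
  inner_dual_self x := by rw [Module.Basis.mk_apply, inner_frameVec_frameDual, if_pos rfl]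
  inner_dual_of_ne x y h := by rw [Module.Basis.mk_apply, inner_frameVec_frameDual, if_neg h]
  lab_inj x y i hx hy := by
    rcases x with s | x <;> rcases y with t | y
    · simp at hx
    · simp at hx
    · simp at hy
    · simp only [Sum.elim_inr, Option.some.injEq] at hx hy
      rw [Subtype.ext (hx.trans hy.symm)]
  span_none := by
    have h1 : frameVec T e b '' {x | Sum.elim (fun _ => none) (fun i => some i.1) x = none} =
        (tangent T e).subtype '' Set.range b := by
      ext z
      constructor
      · rintro ⟨x | x, hx, rfl⟩
        · exact ⟨b x, ⟨x, rfl⟩, rfl⟩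
        · simp at hx
      · rintro ⟨_, ⟨t, rfl⟩, rfl⟩
        exact ⟨Sum.inl t, rfl, rfl⟩
    rw [h1, Submodule.span_image, ← b.coe_toBasis, b.toBasis.span_eq, Submodule.map_top,
      Submodule.range_subtype]
  dual_none x hx := by
    rcases x with x | x
    · rw [Module.Basis.mk_apply]
      rfl
    · simp at hx
  vec_mem_orthogonal x hx := by
    rcases x with x | x
    · simp at hx
    · exact frameVec_inr_mem_orthogonal T e b x

theorem faceFrame_lab (x : FrameIndex e) :
    (faceFrame T e b).lab x = Sum.elim (fun _ => none) (fun i => some i.1) x := rfl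

theorem notMem_of_faceFrame_lab {x : FrameIndex e} {i : Fin (d + 1)}
    (h : (faceFrame T e b).lab x = some i) : i ∉ e.1 := by
  rcases x with x | x
  · simp [faceFrame_lab] at h
  · simp only [faceFrame_lab, Sum.elim_inr, Option.some.injEq] at h
    exact h ▸ x.2

/-- An edge from the base vertex in `e` to a vertex of `f` off `e` differs from its frame vector by
a vector tangent to `e`. -/
theorem tangent_eq_spanOf {f : Face d} (hef : e.1 ⊆ f.1) :
    tangent T f = (faceFrame T e b).spanOf (f.1 \ e.1) := by
  set φ := faceFrame T e b with hφ
  have hl := e.2.choose_spec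
  set l := e.2.choose with hldef
  apply le_antisymm
  · refine tangent_le T (hef hl) fun i hi => ?_
    by_cases hie : i ∈ e.1
    · exact φ.le_spanOf _ (sub_mem_tangent T hie hl)
    · have h1 : T.points i - T.points l = φ.vec (Sum.inr ⟨i, hie⟩) +
          (tangent T e).starProjection (T.points i - T.points l) := by
        change _ = frameVec T e b (Sum.inr ⟨i, hie⟩) + _
        simp only [frameVec, Sum.elim_inr, ← hldef, sub_add_cancel]
      rw [h1]
      refine Submodule.add_mem _ (Submodule.subset_span ⟨_, Or.inr ⟨i, ?_, rfl⟩, rfl⟩)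
        (φ.le_spanOf _ (Submodule.starProjection_apply_mem _ _))
      exact Finset.mem_sdiff.2 ⟨hi, hie⟩
  · refine Submodule.span_le.2 ?_
    rintro _ ⟨x | x, hx, rfl⟩
    · exact tangent_mono T hef (b x).2
    · obtain hx | ⟨i, hi, hx⟩ := hx
      · simp [hφ, faceFrame_lab] at hx
      · simp only [hφ, faceFrame_lab, Sum.elim_inr, Option.some.injEq] at hx
        refine Submodule.sub_mem _ (sub_mem_tangent T ?_ (hef hl))
          (tangent_mono T hef (Submodule.starProjection_apply_mem _ _))
        rw [hx]
        exact (Finset.mem_sdiff.1 hi).1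

theorem starImage_face_eq {f : Face d} (hef : e.1 ⊆ f.1) {k : ℕ} (hk : k ≤ f.dim)
    (bf : OrthonormalBasis (Fin f.dim) ℝ (tangent T f)) :
    starImage (Nat.sub_add_cancel hk) (tangent T f) (tangent T e) bf =
      supportedForms (faceFrame T e b).dual (faceFrame T e b).lab k (f.1 \ e.1) :=
  starImage_eq_supportedForms (faceFrame T e b) _ (tangent_eq_spanOf T e b hef) bf fun i hi =>
    ⟨Sum.inr ⟨i, (Finset.mem_sdiff.1 hi).2⟩, rfl⟩

/-- A nonzero form needs `k` distinct frame indices with label set `F`. Each carries at most one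
label, so |F| ≤ k; only dim e of them can be unlabelled, so k ≤ dim e + |F|. The face is `e ∪ F`, of
dimension dim e + |F|. -/
theorem exists_face_of_supportedForms_ne_bot {k : ℕ} {F : Finset (Fin (d + 1))}
    (h : supportedForms (faceFrame T e b).dual (faceFrame T e b).lab k F ≠ ⊥) :
    ∃ f : Face d, e.1 ⊆ f.1 ∧ k ≤ f.dim ∧ f.dim - k ≤ e.dim ∧ f.1 \ e.1 = F := by
  classical
  obtain ⟨r, hr, hF⟩ := exists_injective_of_supportedForms_ne_bot h
  have hdisj : Disjoint e.1 F := by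
    rw [Finset.disjoint_right]
    intro i hi
    rw [← hF] at hi
    obtain ⟨x, hx⟩ := mem_labelSupport.1 hi
    exact notMem_of_faceFrame_lab T e b hx
  have h1 : F.card ≤ k := by
    rw [← hF]
    refine (Finset.card_biUnion_le_card_mul _ _ 1 fun x _ => ?_).trans (by simp)
    rw [Option.card_toFinset]
    cases (faceFrame T e b).lab (r x) <;> simp
  have h2 : k ≤ e.dim + F.card := by
    have hsub : Finset.univ.image r ⊆ (Finset.univ : Finset (Fin e.dim)).image Sum.inl ∪
        (Finset.univ.filter fun x : {i : Fin (d + 1) // i ∉ e.1} => x.1 ∈ F).image Sum.inr := by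
      intro y hy
      obtain ⟨x, -, rfl⟩ := Finset.mem_image.1 hy
      rcases hx : r x with t | i
      · simp
      · have : i.1 ∈ F := by
          rw [← hF]
          exact mem_labelSupport.2 ⟨x, by rw [hx]; rfl⟩
        simpa using this
    have := (Finset.card_le_card hsub).trans ((Finset.card_union_le _ _).trans
      (Nat.add_le_add Finset.card_image_le Finset.card_image_le))
    rw [Finset.card_image_of_injective _ hr, Finset.card_univ, Finset.card_univ, Fintype.card_fin,
      Fintype.card_fin] at this
    refine this.trans (Nat.add_le_add_left ?_ _)
    exact Finset.card_le_card_of_injOn (fun x => x.1) (fun x hx => by simpa using hx)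
      Subtype.val_injective.injOn
  have h3 : (e.1 ∪ F).card = e.dim + 1 + F.card := by
    rw [Finset.card_union_of_disjoint hdisj, e.card_eq]
  refine ⟨⟨e.1 ∪ F, e.2.mono Finset.subset_union_left⟩, Finset.subset_union_left, ?_, ?_, ?_⟩
  · unfold Face.dim at *
    simp only
    omega
  · unfold Face.dim at *
    simp only
    omega
  · rw [Finset.union_sdiff_cancel_left hdisj]

end Geometry

/-! ### Assembling the decomposition over the monomials. -/

section Decomposition

variable {d : ℕ} (T : Affine.Simplex ℝ (EuclideanSpace ℝ (Fin d)) d)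

theorem map_bubble_polyFace (e : Face d) (r : ℕ) :
    (polyFace T e ((r : ℤ) - (e.dim + 1))).map (LinearMap.mulLeft ℝ (bubble T e)) =
      Submodule.span ℝ {p | ∃ α : Exponent d r, α.supp = e.1 ∧ p = baryMonomial T α} := by
  classical
  rw [polyFace, Submodule.map_span]
  congr 1
  have hb : ∀ x, bubble T e x = ∏ i, bary T i x ^ (if i ∈ e.1 then 1 else 0) := by
    intro x
    simp only [pow_ite, pow_one, pow_zero, Finset.prod_ite_mem, Finset.univ_inter, bubble]
  have hsum : ∑ i, (if i ∈ e.1 then 1 else 0) = e.dim + 1 := by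
    rw [← e.card_eq]
    simp
  ext p
  constructor
  · rintro ⟨_, ⟨α, hα, hq, rfl⟩, rfl⟩
    refine ⟨Exponent.mk (fun i => (if i ∈ e.1 then 1 else 0) + α i) ?_, ?_, ?_⟩
    · rw [Finset.sum_add_distrib, hsum]
      omega
    · ext i
      rw [Exponent.mem_supp]
      by_cases hi : i ∈ e.1
      · simp [Exponent.mk, hi]
      · simp [Exponent.mk, hi, hα i hi]
    · funext x
      simp only [LinearMap.mulLeft_apply, Pi.mul_apply, hb, ← Finset.prod_mul_distrib, ← pow_add]
      rfl
  · rintro ⟨α, hα, rfl⟩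
    have hmem : ∀ i, i ∈ e.1 ↔ α.1 i ≠ 0 := fun i => by rw [← hα, Exponent.mem_supp]
    -- The truncated subtraction is exact, because `α` is at least 1 on its support `e`.
    have hsub : ∀ i, (if i ∈ e.1 then 1 else 0) + (α.1 i - if i ∈ e.1 then 1 else 0) = α.1 i := by
      intro i
      have := hmem i
      split_ifs with h
      · have := this.1 h
        omega
      · omega
    refine ⟨_, ⟨fun i => α.1 i - if i ∈ e.1 then 1 else 0, fun i hi => ?_, ?_, rfl⟩, ?_⟩
    · have := mt (hmem i).2 hi
      simp only
      omega
    · have h1 := α.sum_eq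
      rw [← Finset.sum_congr rfl fun i _ => hsub i, Finset.sum_add_distrib, hsum] at h1
      change ((∑ i, (α.1 i - if i ∈ e.1 then 1 else 0) : ℕ) : ℤ) = _
      omega
    · funext x
      simp only [LinearMap.mulLeft_apply, Pi.mul_apply, hb, ← Finset.prod_mul_distrib, ← pow_add,
        hsub]
      rfl

theorem polyFace_eq_span (f : Face d) (r : ℕ) :
    polyFace T f r =
      Submodule.span ℝ {p | ∃ α : Exponent d r, α.supp ⊆ f.1 ∧ p = baryMonomial T α} := by
  rw [polyFace]
  congr 1
  ext p
  constructor
  · rintro ⟨α, hα, hr, rfl⟩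
    refine ⟨Exponent.mk α (by exact_mod_cast hr), fun i hi => ?_, rfl⟩
    by_contra hc
    exact Exponent.mem_supp.1 hi (hα i hc)
  · rintro ⟨α, hα, rfl⟩
    refine ⟨α.1, fun i hi => ?_, by exact_mod_cast α.sum_eq, rfl⟩
    by_contra hc
    exact hi (hα (Exponent.mem_supp.2 hc))

variable {k r : ℕ}

theorem bubbleTerm_eq_map (f : Face d) (b : OrthonormalBasis (Fin f.dim) ℝ (tangent T f))
    (hk : k ≤ f.dim) (e : Face d) :
    bubbleTerm T f b r k hk e =
      (Submodule.pi Set.univ fun α : Exponent d r => if α.supp = e.1 then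
        starImage (Nat.sub_add_cancel hk) (tangent T f) (tangent T e) b else ⊥).map
          (combine (baryMonomial T)) := by
  rw [map_combine_eq_tensor (baryMonomial T) (fun α : Exponent d r => α.supp = e.1),
    ← map_bubble_polyFace]
  exact map_tensor _ _ _ _

theorem polyFormsFace_eq_map (f : Face d) :
    polyFormsFace T f r k = (Submodule.pi Set.univ fun α : Exponent d r => if α.supp ⊆ f.1 then
        LinearMap.range (extendForm k (tangent T f)) else ⊥).map (combine (baryMonomial T)) := by
  rw [map_combine_eq_tensor (baryMonomial T) (fun α : Exponent d r => α.supp ⊆ f.1),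
    ← polyFace_eq_span]
  rfl

theorem polyFormsT_eq_map :
    polyFormsT T r k = (⊤ : Submodule ℝ (Exponent d r → Alt k (EuclideanSpace ℝ (Fin d)))).map
      (combine (baryMonomial T)) := by
  have h := map_combine_eq_tensor (baryMonomial T) (fun _ : Exponent d r => True)
    (⊤ : Submodule ℝ (Alt k (EuclideanSpace ℝ (Fin d))))
  simp only [if_true, Submodule.pi_top, true_and] at h
  rw [h, polyFormsT, polyT_eq_span]
  congr 2
  ext p
  simp [eq_comm]

/-- The polynomial forms are the direct sum of all the pieces `b_e ⋆_f P_{r-(s+1)}Λ^{ℓ-k}(e)`. -/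
theorem isDirectSum_bubbleTerm
    (b : ∀ f : Face d, OrthonormalBasis (Fin f.dim) ℝ (tangent T f)) (hr : 1 ≤ r) :
    IsDirectSum (polyFormsT T r k)
      fun p : Σ f : {f : Face d // k ≤ f.dim}, BubbleIndex f.1 k =>
        bubbleTerm T p.1.1 (b p.1.1) r k p.1.2 p.2.1 := by
  simp only [bubbleTerm_eq_map, polyFormsT_eq_map]
  refine IsDirectSum.map (IsDirectSum.pi fun α => ?_)
    (combine_injective (baryMonomial_independent T))
  -- At the coefficient `α` only the pieces with this `e` are nonzero; `1 ≤ r` makes the support a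
  -- face.
  set e : Face d := ⟨α.supp, α.supp_nonempty hr⟩ with he
  have heq : ∀ p : Σ f : {f : Face d // k ≤ f.dim}, BubbleIndex f.1 k,
      α.supp = p.2.1.1 → p.2.1 = e := fun p hp => Subtype.ext hp.symm
  -- The piece of `f` corresponds to the label set `f \ e`, from which `f` is recovered as its union
  -- with `e`.
  refine (isDirectSum_supportedForms (faceFrame T e (b e)).dual (faceFrame T e (b e)).lab).reindex
    (fun p => α.supp = p.2.1.1) (fun p => p.1.1.1 \ e.1) ?_ ?_ ?_ ?_
  · rintro ⟨⟨f, hf⟩, ⟨e₁, h₁⟩⟩ ⟨⟨g, hg⟩, ⟨e₂, h₂⟩⟩ hp hq h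
    obtain rfl : e₁ = e := heq ⟨⟨f, hf⟩, ⟨e₁, h₁⟩⟩ hp
    obtain rfl : e₂ = e := heq ⟨⟨g, hg⟩, ⟨e₂, h₂⟩⟩ hq
    have hfg : f = g := by
      apply Subtype.ext
      rw [← Finset.union_sdiff_of_subset h₁.1, ← Finset.union_sdiff_of_subset h₂.1]
      exact congrArg _ h
    subst hfg
    rfl
  · rintro ⟨⟨f, hf⟩, ⟨e₁, h₁⟩⟩ hp
    obtain rfl : e₁ = e := heq ⟨⟨f, hf⟩, ⟨e₁, h₁⟩⟩ hp
    rw [if_pos hp]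
    exact starImage_face_eq T _ (b _) h₁.1 hf (b f)
  · intro p hp
    rw [if_neg hp]
  · intro F hF
    obtain ⟨f, hef, hk, hd, hFe⟩ := exists_face_of_supportedForms_ne_bot T e (b e) hF
    exact ⟨⟨⟨f, hk⟩, ⟨e, hef, hd⟩⟩, rfl, hFe⟩

/-- On a `k`-dimensional face the bubble forms are all the polynomial `k`-forms. -/
theorem bubbleForms_eq_polyFormsFace (f : Face d)
    (b : OrthonormalBasis (Fin f.dim) ℝ (tangent T f)) (hf : f.dim = k) (hr : 1 ≤ r) :
    bubbleForms T f b r k hf.ge = polyFormsFace T f r k := by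
  rw [polyFormsFace_eq_map, bubbleForms]
  simp only [bubbleTerm_eq_map]
  rw [← Submodule.map_iSup, iSup_pi_univ]
  congr 2
  funext α
  apply le_antisymm
  · refine iSup_le fun e => ?_
    split_ifs with h1 h2 h2
    · exact (starImage_eq_range _ hf.symm (tangent_mono T e.2.1) b).le
    · exact absurd (h1.trans_subset e.2.1) h2
    · exact bot_le
    · exact bot_le
  · split_ifs with h
    -- The piece with `e` equal to the support of `α` already supplies the full coefficient space.
    · refine le_iSup_of_le (⟨⟨α.supp, α.supp_nonempty hr⟩, h, by omega⟩ : BubbleIndex f k) ?_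
      rw [if_pos rfl]
      exact (starImage_eq_range _ hf.symm (tangent_mono T h) b).ge
    · exact bot_le

end Decomposition

end BubbleForms

theorem theorem6p3 {d : ℕ} (T : Affine.Simplex ℝ (EuclideanSpace ℝ (Fin d)) d)
    (b : ∀ f : BubbleForms.Face d, OrthonormalBasis (Fin f.dim) ℝ (BubbleForms.tangent T f))
    (k r : ℕ) (hk : k ≤ d) (hr : 1 ≤ r) :
    -- the sums that define the bubble spaces are direct
    (∀ (f : BubbleForms.Face d) (hf : k ≤ f.dim),
      BubbleForms.IsDirectSum (BubbleForms.bubbleForms T f (b f) r k hf)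
        (fun e : BubbleForms.BubbleIndex f k =>
          BubbleForms.bubbleTerm T f (b f) r k hf e.1)) ∧
    -- `P_rΛ^k(T)` is the direct sum of the bubble spaces of the faces of dimension `≥ k`
    BubbleForms.IsDirectSum (BubbleForms.polyFormsT T r k)
      (fun f : {f : BubbleForms.Face d // k ≤ f.dim} =>
        BubbleForms.bubbleForms T f.1 (b f.1) r k f.2) ∧
    -- `P_rΛ^k(T)` is the direct sum of the `P_rΛ^k(f)`, `dim f = k`, and the bubble spaces of the
    -- faces of dimension `> k`
    BubbleForms.IsDirectSum (BubbleForms.polyFormsT T r k)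
      (Sum.elim
        (fun f : {f : BubbleForms.Face d // f.dim = k} =>
          BubbleForms.polyFormsFace T f.1 (r : ℤ) k)
        (fun f : {f : BubbleForms.Face d // k < f.dim} =>
          BubbleForms.bubbleForms T f.1 (b f.1) r k f.2.le)) := by
  have hall := BubbleForms.isDirectSum_bubbleTerm T (k := k) b hr
  have hgroup : BubbleForms.IsDirectSum (BubbleForms.polyFormsT T r k)
      (fun f : {f : BubbleForms.Face d // k ≤ f.dim} =>
        BubbleForms.bubbleForms T f.1 (b f.1) r k f.2) := hall.group
  refine ⟨fun f hf => ⟨?_, rfl⟩, hgroup, ?_⟩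
  -- The pieces of one face form a subfamily of the independent family of all pieces.
  · exact hall.1.comp (f := fun e : BubbleForms.BubbleIndex f k =>
      (⟨⟨f, hf⟩, e⟩ : Σ f : {f : BubbleForms.Face d // k ≤ f.dim}, BubbleForms.BubbleIndex f.1 k))
      fun _ _ h => eq_of_heq (Sigma.mk.inj h).2
  · refine hgroup.reindex (fun _ => True)
      (Sum.elim (fun f => ⟨f.1, f.2.ge⟩) fun f => ⟨f.1, f.2.le⟩) ?_ ?_ (by simp) ?_
    · rintro (⟨f, hf⟩ | ⟨f, hf⟩) (⟨g, hg⟩ | ⟨g, hg⟩) - - h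
      all_goals
        obtain rfl : f = g := congrArg (fun x => x.1) h
        first
        | rfl
        | omega
    · rintro (⟨f, hf⟩ | ⟨f, hf⟩) -
      · exact (BubbleForms.bubbleForms_eq_polyFormsFace T f (b f) hf hr).symm
      · rfl
    · rintro ⟨f, hf⟩ -
      rcases hf.lt_or_eq with h | h
      · exact ⟨Sum.inr ⟨f, h⟩, trivial, rfl⟩
      · exact ⟨Sum.inl ⟨f, h.symm⟩, trivial, rfl⟩
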